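/- Let $\mathbb{D}=\{z\in\mathbb{C}:|z|<1\}$ and let $-1\le B<A\le 1$. Let $\mathcal{C}(A,B)$ be the class of Janowski convex functions, i.e. of analytic functions $f(z)=z+\sum_{n\ge2}a_nz^n$ in $\mathbb{D}$, with $f'\neq0$ in $\mathbb{D}$, such that $$1+\frac{zf''(z)}{f'(z)}=\frac{1+A\,\omega(z)}{1+B\,\omega(z)}\qquad(z\in\mathbb{D})$$ for some analytic $\omega:\mathbb{D}\to\mathbb{D}$ with $\omega(0)=0$. The logarithmic coefficients $\gamma_n=\gamma_n(f)$ are defined by $\log\frac{f(z)}{z}=2\sum_{n\ge1}\gamma_nz^n$ near $0$, with the branch of the logarithm that vanishes at $z=0$. Put $\mu=\frac12(A-5B)$, $\nu=\frac12(3B^2-AB)$, and define the following sets of pairs $(\mu,\nu)\in\mathbb{R}^2$: \begin{align*} D_1&=\{|\mu|\le\tfrac12,\ -1<\nu\le1\},\\ D_2&=\{\tfrac12\le|\mu|\le2,\ \tfrac4{27}(|\mu|+1)^3-(|\mu|+1)\le\nu\le1\},\\ D_6&=\{2\le|\mu|\le4,\ \nu\ge\tfrac1{12}(\mu^2+8)\},\\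 D_8&=\{\tfrac12\le|\mu|\le2,\ -\tfrac23(|\mu|+1)\le\nu\le\tfrac4{27}(|\mu|+1)^3-(|\mu|+1)\},\\ D_9&=\Bigl\{|\mu|\ge2,\ -\tfrac23(|\mu|+1)\le\nu\le\tfrac{2|\mu|(|\mu|+1)}{\mu^2+2|\mu|+4}\Bigr\}. \end{align*} Then every $f\in\mathcal{C}(A,B)$ satisfies \begin{align*} |\gamma_1|&\le\frac{A-B}{4},\\ |\gamma_2|&\le\begin{cases}\dfrac{A-B}{12}&\text{if }|A-5B|\le4,\\[2mm]\dfrac{A-B}{48}|A-5B|&\text{if }|A-5B|>4,\end{cases}\\ |\gamma_3|&\le\begin{cases}\dfrac{A-B}{24}&\text{if }(\mu,\nu)\in D_1\cup D_2,\\[2mm]\dfrac{A-B}{48}|B(A-3B)|&\text{if }(\mu,\nu)\in D_6,\\[2mm]\dfrac{A-B}{72\sqrt3}\cdot\dfrac{(|A-5B|+2)^{3/2}}{\sqrt{|A-5B|+2+3B^2-AB}}&\text{if }(\mu,\nu)\in D_8\cup D_9\end{cases} \end{align*} (for $\gamma_3$ nothing is claimed when $(\mu,\nu)$ lies in none of these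 sets). All these estimates are sharp: for each admissible pair $(A,B)$ and each applicable case, equality is attained by some $f\in\mathcal{C}(A,B)$. In particular, the estimates $|\gamma_2|\le\frac{5|B|^2}{48}$ and $|\gamma_3|\le\frac{|B|^3}{16}$ do not hold for all $B\in[-0.99,0)$ and all $f\in\mathcal{C}(0,B)$: each of them fails for some such $B$ and $f$. -/

import Mathlib

namespace JanowskiConvex

noncomputable section

/-- The open unit disk in the complex plane. -/
def unitDisk : Set ℂ := Metric.ball (0 : ℂ) 1

/-- Normalized analytic functions `f(z) = z + a₂ z² + ⋯` in the unit disk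
(the values of `f` outside the disk are irrelevant). -/
def classA : Set (ℂ → ℂ) :=
  {f | AnalyticOnNhd ℂ f unitDisk ∧ f 0 = 0 ∧ deriv f 0 = 1}

/-- Subordination `f ≺ g` in the unit disk: `f = g ∘ ω` for a Schwarz function `ω`. -/
def Subordinate (f g : ℂ → ℂ) : Prop :=
  ∃ ω : ℂ → ℂ, AnalyticOnNhd ℂ ω unitDisk ∧ Set.MapsTo ω unitDisk unitDisk ∧ ω 0 = 0 ∧
    ∀ z ∈ unitDisk, f z = g (ω z)

/-- The class `C(A, B)` of Janowski convex functions. The condition `f' ≠ 0` says that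
`1 + z f'' / f'` is an analytic function in the disk. -/
def classC (A B : ℝ) : Set (ℂ → ℂ) :=
  {f | f ∈ classA ∧ (∀ z ∈ unitDisk, deriv f z ≠ 0) ∧
    Subordinate (fun z => 1 + z * deriv (deriv f) z / deriv f z)
      (fun z => (1 + (A : ℂ) * z) / (1 + (B : ℂ) * z))}

/-- The logarithmic coefficients `γₙ` of `f ∈ classA`: half the Taylor coefficients at `0` of
`log (f z / z)`. Here `dslope f 0 z` is `f z / z` for `z ≠ 0` and is `f' 0 = 1` at `z = 0`, so
that the principal logarithm is the analytic branch near `0` that vanishes at `0`. -/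
def logCoeff (f : ℂ → ℂ) (n : ℕ) : ℂ :=
  iteratedDeriv n (fun z => Complex.log (dslope f 0 z)) 0 / (n.factorial : ℂ) / 2

/-- The set of the values `|γₙ(f)|` for `f ∈ C(A, B)`. -/
def logCoeffValues (A B : ℝ) (n : ℕ) : Set ℝ :=
  {x | ∃ f ∈ classC A B, x = ‖logCoeff f n‖}

def D1 : Set (ℝ × ℝ) :=
  {p | |p.1| ≤ 1 / 2 ∧ -1 < p.2 ∧ p.2 ≤ 1}

def D2 : Set (ℝ × ℝ) :=
  {p | 1 / 2 ≤ |p.1| ∧ |p.1| ≤ 2 ∧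
    4 / 27 * (|p.1| + 1) ^ 3 - (|p.1| + 1) ≤ p.2 ∧ p.2 ≤ 1}

def D6 : Set (ℝ × ℝ) :=
  {p | 2 ≤ |p.1| ∧ |p.1| ≤ 4 ∧ 1 / 12 * (p.1 ^ 2 + 8) ≤ p.2}

def D8 : Set (ℝ × ℝ) :=
  {p | 1 / 2 ≤ |p.1| ∧ |p.1| ≤ 2 ∧ -(2 / 3) * (|p.1| + 1) ≤ p.2 ∧
    p.2 ≤ 4 / 27 * (|p.1| + 1) ^ 3 - (|p.1| + 1)}

def D9 : Set (ℝ × ℝ) :=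
  {p | 2 ≤ |p.1| ∧ -(2 / 3) * (|p.1| + 1) ≤ p.2 ∧
    p.2 ≤ 2 * |p.1| * (|p.1| + 1) / (p.1 ^ 2 + 2 * |p.1| + 4)}

/-- The point `(μ, ν) = ((A - 5B) / 2, (3B² - AB) / 2)`. -/
def paramPoint (A B : ℝ) : ℝ × ℝ :=
  ((A - 5 * B) / 2, (3 * B ^ 2 - A * B) / 2)

end

end JanowskiConvex

/-!
In `1 + z f'' / f' = (1 + A ω) / (1 + B ω)` the Schwarz function `ω` can be prescribed, since the
equation is solved for `f` by two integrations. Comparing coefficients, `γ₁`, `γ₂`, `γ₃` are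
constant multiples of `c₁`, of the Fekete–Szegő functional `c₂ + κ c₁²` and of the
Prokhorov–Szynal functional `c₃ + μ c₁ c₂ + ν c₁³` of `ω = c₁ z + c₂ z² + ⋯`.

The Schur algorithm parametrizes `(c₁, c₂, c₃)` by three points of the closed disk. After the
last point is eliminated by the triangle inequality and the phase of `c₁` is factored out, the
Prokhorov–Szynal functional is bounded by an expression in `t = |c₁| ∈ [0, 1]` and one point `X`
of the closed disk. Its maximum is `1`, `ν`, or that of a cubic `p t - q t³`, according to the
region of `(μ, ν)`.
-/

namespace JanowskiConvex

open Complex Filter Topology Metric Set ComplexConjugate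

/-- The `n`-th Taylor coefficient of `f` at `0`. -/
noncomputable def taylorCoeff (f : ℂ → ℂ) (n : ℕ) : ℂ := iteratedDeriv n f 0 / (n.factorial : ℂ)

section TaylorCoeff

variable {f g : ℂ → ℂ}

lemma taylorCoeff_congr (h : f =ᶠ[𝓝 0] g) (n : ℕ) : taylorCoeff f n = taylorCoeff g n := by
  rw [taylorCoeff, taylorCoeff, (h.iteratedDeriv n).eq_of_nhds]

@[simp]
lemma taylorCoeff_zero (f : ℂ → ℂ) : taylorCoeff f 0 = f 0 := by simp [taylorCoeff]

lemma taylorCoeff_deriv (f : ℂ → ℂ) (n : ℕ) :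
    taylorCoeff (deriv f) n = (n + 1) * taylorCoeff f (n + 1) := by
  have hn : ((n : ℂ) + 1) ≠ 0 := Nat.cast_add_one_ne_zero n
  rw [taylorCoeff, taylorCoeff, iteratedDeriv_succ', Nat.factorial_succ]
  push_cast
  field_simp

lemma taylorCoeff_add (hf : AnalyticAt ℂ f 0) (hg : AnalyticAt ℂ g 0) (n : ℕ) :
    taylorCoeff (fun z => f z + g z) n = taylorCoeff f n + taylorCoeff g n := by
  rw [taylorCoeff, iteratedDeriv_fun_add hf.contDiffAt hg.contDiffAt, add_div, taylorCoeff,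
    taylorCoeff]

lemma taylorCoeff_mul (hf : AnalyticAt ℂ f 0) (hg : AnalyticAt ℂ g 0) (n : ℕ) :
    taylorCoeff (fun z => f z * g z) n =
      ∑ i ∈ Finset.range (n + 1), taylorCoeff f i * taylorCoeff g (n - i) := by
  rw [taylorCoeff, iteratedDeriv_fun_mul hf.contDiffAt hg.contDiffAt, Finset.sum_div]
  refine Finset.sum_congr rfl fun i hi => ?_
  rw [taylorCoeff, taylorCoeff, Nat.cast_choose ℂ (Finset.mem_range_succ_iff.1 hi)]
  have hn : (n.factorial : ℂ) ≠ 0 := Nat.cast_ne_zero.2 n.factorial_ne_zero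
  field_simp

lemma taylorCoeff_const_mul (c : ℂ) (f : ℂ → ℂ) (n : ℕ) :
    taylorCoeff (fun z => c * f z) n = c * taylorCoeff f n := by
  simp [taylorCoeff, mul_div_assoc]

lemma taylorCoeff_const_succ (c : ℂ) (n : ℕ) : taylorCoeff (fun _ => c) (n + 1) = 0 := by
  simp [taylorCoeff, iteratedDeriv_const]

lemma taylorCoeff_pow (k n : ℕ) : taylorCoeff (fun z => z ^ k) n = if n = k then 1 else 0 := by
  rw [taylorCoeff, iteratedDeriv_fun_pow_zero]
  split_ifs with h
  · subst h
    simp [Nat.factorial_ne_zero]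
  · simp

lemma taylorCoeff_id (n : ℕ) : taylorCoeff (fun z => z) n = if n = 1 then 1 else 0 := by
  simpa only [pow_one] using taylorCoeff_pow 1 n

lemma taylorCoeff_id_mul_succ (hf : AnalyticAt ℂ f 0) (n : ℕ) :
    taylorCoeff (fun z => z * f z) (n + 1) = taylorCoeff f n := by
  rw [taylorCoeff_mul (f := fun z => z) analyticAt_id hf]
  simp [taylorCoeff_id]

lemma taylorCoeff_id_mul_deriv (hf : AnalyticAt ℂ f 0) (n : ℕ) :
    taylorCoeff (fun z => z * deriv f z) n = n * taylorCoeff f n := by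
  cases n with
  | zero => simp
  | succ n => rw [taylorCoeff_id_mul_succ hf.deriv, taylorCoeff_deriv, Nat.cast_succ]

lemma mul_dslope_zero (h0 : f 0 = 0) (z : ℂ) : z * dslope f 0 z = f z := by
  simpa [h0] using sub_smul_dslope f 0 z

lemma analyticAt_dslope_zero (hf : AnalyticAt ℂ f 0) : AnalyticAt ℂ (dslope f 0) 0 :=
  let ⟨_, hp⟩ := hf
  hp.has_fpower_series_dslope_fslope.analyticAt

lemma taylorCoeff_dslope_zero (hf : AnalyticAt ℂ f 0) (h0 : f 0 = 0) (n : ℕ) :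
    taylorCoeff (dslope f 0) n = taylorCoeff f (n + 1) := by
  rw [← taylorCoeff_id_mul_succ (analyticAt_dslope_zero hf), funext (mul_dslope_zero h0)]

lemma mul_deriv_log_eventuallyEq (hf : AnalyticAt ℂ f 0) (h0 : f 0 ∈ slitPlane) :
    (fun z => f z * deriv (fun w => log (f w)) z) =ᶠ[𝓝 0] deriv f := by
  filter_upwards [hf.continuousAt.eventually (isOpen_slitPlane.mem_nhds h0),
    hf.eventually_analyticAt] with z hz hfz
  have hne : f z ≠ 0 := slitPlane_ne_zero hz
  rw [(hfz.differentiableAt.hasDerivAt.clog hz).deriv]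
  field_simp

lemma sum_taylorCoeff_mul_taylorCoeff_log (hf : AnalyticAt ℂ f 0) (h0 : f 0 ∈ slitPlane) (n : ℕ) :
    ∑ i ∈ Finset.range (n + 1),
        taylorCoeff f i * (((n - i : ℕ) + 1) * taylorCoeff (fun z => log (f z)) (n - i + 1)) =
      (n + 1) * taylorCoeff f (n + 1) := by
  rw [← taylorCoeff_deriv, ← taylorCoeff_congr (mul_deriv_log_eventuallyEq hf h0),
    taylorCoeff_mul hf (hf.clog h0).deriv]
  simp only [taylorCoeff_deriv]

lemma taylorCoeff_log (hf : AnalyticAt ℂ f 0) (h0 : f 0 = 1) :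
    taylorCoeff (fun z => log (f z)) 1 = taylorCoeff f 1 ∧
    taylorCoeff (fun z => log (f z)) 2 = taylorCoeff f 2 - taylorCoeff f 1 ^ 2 / 2 ∧
    taylorCoeff (fun z => log (f z)) 3 =
      taylorCoeff f 3 - taylorCoeff f 1 * taylorCoeff f 2 + taylorCoeff f 1 ^ 3 / 3 := by
  have hrec := sum_taylorCoeff_mul_taylorCoeff_log hf (h0 ▸ one_mem_slitPlane)
  have h1 := hrec 0
  have h2 := hrec 1
  have h3 := hrec 2
  norm_num [Finset.sum_range_succ, h0] at h1 h2 h3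
  rw [h1] at h2 h3
  have h2' : taylorCoeff (fun z => log (f z)) 2 = taylorCoeff f 2 - taylorCoeff f 1 ^ 2 / 2 := by
    linear_combination h2 / 2
  rw [h2'] at h3
  exact ⟨h1, h2', by linear_combination h3 / 3⟩

lemma logCoeff_eq_taylorCoeff (hf : AnalyticAt ℂ f 0) (h0 : f 0 = 0) (h1 : deriv f 0 = 1) :
    logCoeff f 1 = taylorCoeff f 2 / 2 ∧
    logCoeff f 2 = (taylorCoeff f 3 - taylorCoeff f 2 ^ 2 / 2) / 2 ∧
    logCoeff f 3 =
      (taylorCoeff f 4 - taylorCoeff f 2 * taylorCoeff f 3 + taylorCoeff f 2 ^ 3 / 3) / 2 := by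
  have hlog := taylorCoeff_log (analyticAt_dslope_zero hf) (by rw [dslope_same, h1])
  simp only [taylorCoeff_dslope_zero hf h0] at hlog
  exact ⟨congrArg (· / 2) hlog.1, congrArg (· / 2) hlog.2.1, congrArg (· / 2) hlog.2.2⟩

end TaylorCoeff

section CubicMax

variable {p q : ℝ}

/-- The maximum of `p t - q t ^ 3` over `t ≥ 0` for `p, q > 0`, attained at `t = √(p / (3 q))`. -/
noncomputable def cubicMax (p q : ℝ) : ℝ := 2 / 3 * p * √(p / (3 * q))

lemma cubicMax_nonneg (hp : 0 ≤ p) : 0 ≤ cubicMax p q := by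
  rw [cubicMax]
  positivity

lemma cubicMax_sq (hp : 0 < p) (hq : 0 < q) :
    cubicMax p q ^ 2 = (2 / 3 * p) ^ 2 * (p / (3 * q)) := by
  rw [cubicMax, mul_pow, Real.sq_sqrt (by positivity)]

lemma cubicMax_sq_eq_div (hp : 0 < p) (hq : 0 < q) :
    cubicMax p q ^ 2 = 4 * p ^ 3 / (27 * q) := by
  rw [cubicMax_sq hp hq]
  field_simp
  norm_num

lemma one_le_cubicMax (hp : 0 < p) (hq : 0 < q) (h : 27 * q ≤ 4 * p ^ 3) : 1 ≤ cubicMax p q := by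
  refine (one_le_sq_iff₀ (cubicMax_nonneg hp.le)).1 ?_
  rwa [cubicMax_sq_eq_div hp hq, one_le_div (by positivity)]

lemma cubicMax_le_one (hp : 0 < p) (hq : 0 < q) (h : 4 * p ^ 3 ≤ 27 * q) : cubicMax p q ≤ 1 := by
  refine (sq_le_one_iff₀ (cubicMax_nonneg hp.le)).1 ?_
  rwa [cubicMax_sq_eq_div hp hq, div_le_one (by positivity)]

lemma exists_cubic_eq_cubicMax (hp : 0 ≤ p) (hpq : p ≤ 3 * q) :
    ∃ t : ℝ, 0 ≤ t ∧ t ≤ 1 ∧ p * t - q * t ^ 3 = cubicMax p q := by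
  have hq : 0 ≤ 3 * q := hp.trans hpq
  refine ⟨√(p / (3 * q)), Real.sqrt_nonneg _, Real.sqrt_le_one.2 (div_le_one_of_le₀ hpq hq), ?_⟩
  have hmul : q * (p / (3 * q)) = p / 3 := by
    rcases hq.eq_or_lt with h | h
    · have : p = 0 := le_antisymm (hpq.trans_eq h.symm) hp
      simp [this]
    · have : q ≠ 0 := by linarith
      field_simp
  rw [pow_succ, Real.sq_sqrt (div_nonneg hp hq), cubicMax]
  linear_combination (-√(p / (3 * q))) * hmul

/-- Weighted AM-GM: the hypothesis says `(2 * (x / a) + y / b) / 3 ≤ 1`. -/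
lemma sq_mul_le_sq_mul {a b x y : ℝ} (ha : 0 < a) (hb : 0 ≤ b) (hx : 0 ≤ x)
    (h : 2 * b * x + a * y ≤ 3 * a * b) : x ^ 2 * y ≤ a ^ 2 * b := by
  refine le_of_mul_le_mul_left ?_ ha
  calc a * (x ^ 2 * y) = x ^ 2 * (a * y) := by ring
    _ ≤ x ^ 2 * (3 * a * b - 2 * b * x) := by gcongr; linarith
    _ = a * (a ^ 2 * b) - b * ((a - x) ^ 2 * (a + 2 * x)) := by ring
    _ ≤ a * (a ^ 2 * b) := sub_le_self _ (by positivity)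

lemma sq_sub_mul_mul_le_cubicMax_sq (hp : 0 < p) (hq : 0 < q) {T : ℝ} (hT : q * T ≤ p) :
    (p - q * T) ^ 2 * T ≤ cubicMax p q ^ 2 := by
  rw [cubicMax_sq hp hq]
  refine sq_mul_le_sq_mul (by positivity) (by positivity) (sub_nonneg.2 hT) (le_of_eq ?_)
  field_simp
  ring

lemma cubic_le_cubicMax (hp : 0 < p) (hq : 0 < q) {t : ℝ} (ht : 0 ≤ t) :
    p * t - q * t ^ 3 ≤ cubicMax p q := by
  have hfactor : p * t - q * t ^ 3 = (p - q * t ^ 2) * t := by ring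
  rcases le_total (p - q * t ^ 2) 0 with hneg | hpos
  · rw [hfactor]
    exact (mul_nonpos_of_nonpos_of_nonneg hneg ht).trans (cubicMax_nonneg hp.le)
  · refine (abs_le_of_sq_le_sq' ?_ (cubicMax_nonneg hp.le)).2
    rw [hfactor, mul_pow]
    exact sq_sub_mul_mul_le_cubicMax_sq hp hq (sub_nonneg.1 hpos)

end CubicMax

section Majorant

variable {μ ν t r : ℝ} {X : ℂ}

/-- If `c₁ = t`, `c₂ = (1 - t²) X` and `c₃ = (1 - t²) (y - t X²)`, then
`c₃ + μ c₁ c₂ + ν c₁³ = (1 - t²) y + t * innerTerm μ ν t X`. -/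
noncomputable def innerTerm (μ ν t : ℝ) (X : ℂ) : ℂ := ν * t ^ 2 + (1 - t ^ 2) * (μ * X - X ^ 2)

/-- The largest modulus of `(1 - t²) y + t * innerTerm μ ν t X` over `‖y‖ ≤ 1 - ‖X‖²`, for
`0 ≤ t ≤ 1`. -/
noncomputable def majorant (μ ν t : ℝ) (X : ℂ) : ℝ :=
  (1 - t ^ 2) * (1 - ‖X‖ ^ 2) + t * ‖innerTerm μ ν t X‖

/-- The real function to which `majorant` reduces at its worst phase `X = -r`, for `μ ≥ 0`. -/
noncomputable def realMajorant (μ ν t r : ℝ) : ℝ :=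
  (1 - t ^ 2) * (1 - r ^ 2) + t * ((1 - t ^ 2) * (μ * r + r ^ 2) - ν * t ^ 2)

lemma realMajorant_one (μ ν t : ℝ) :
    realMajorant μ ν t 1 = (μ + 1) * t - (μ + 1 + ν) * t ^ 3 := by
  rw [realMajorant]
  ring

lemma realMajorant_le_realMajorant_one (ht0 : 0 ≤ t) (ht1 : t ≤ 1) (hr : r ≤ 1)
    (h : 2 * (1 - t) ≤ t * μ) : realMajorant μ ν t r ≤ realMajorant μ ν t 1 := by
  have hdiff : realMajorant μ ν t 1 - realMajorant μ ν t r =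
      (1 - t) * (1 + t) * (1 - r) * (t * μ - (1 - t) * (1 + r)) := by
    simp only [realMajorant]
    ring
  refine sub_nonneg.1 (hdiff ▸ mul_nonneg (mul_nonneg (mul_nonneg ?_ ?_) ?_) ?_)
  · linarith
  · linarith
  · linarith
  · linarith [mul_nonneg (sub_nonneg.2 ht1) (sub_nonneg.2 hr)]

/-- The right-hand side is the value at the vertex `r = t μ / (2 (1 - t))`. -/
lemma realMajorant_le_vertex (ht : 0 ≤ t) :
    realMajorant μ ν t r ≤ 1 + t ^ 2 * ((μ ^ 2 / 4 - 1) + t * (μ ^ 2 / 4 - ν)) := by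
  have hdiff : 1 + t ^ 2 * ((μ ^ 2 / 4 - 1) + t * (μ ^ 2 / 4 - ν)) - realMajorant μ ν t r =
      (1 + t) * ((1 - t) * r - t * μ / 2) ^ 2 := by
    rw [realMajorant]
    ring
  exact sub_nonneg.1 (hdiff ▸ by positivity)

lemma one_add_sq_mul_le_max {a b u : ℝ} (hb : 0 ≤ b) (ht : 0 ≤ t) (htu : t ≤ u) :
    1 + t ^ 2 * (a + t * b) ≤ max 1 (1 + u ^ 2 * (a + u * b)) := by
  have hle : a + t * b ≤ a + u * b := by gcongr
  rcases le_total (a + u * b) 0 with hneg | hpos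
  · exact le_max_of_le_left (by nlinarith [sq_nonneg t])
  · refine le_max_of_le_right ?_
    gcongr 1 + ?_
    exact (mul_le_mul_of_nonneg_left hle (sq_nonneg t)).trans (by gcongr)

lemma realMajorant_le_max_cubicMax (hμ : 0 ≤ μ) (hq : 0 < μ + 1 + ν) (hν : 4 * ν ≤ μ ^ 2)
    (ht0 : 0 ≤ t) (ht1 : t ≤ 1) (hr : r ≤ 1) :
    realMajorant μ ν t r ≤ max 1 (cubicMax (μ + 1) (μ + 1 + ν)) := by
  have hp : 0 < μ + 1 := by linarith
  have hone (s : ℝ) (hs : 0 ≤ s) : realMajorant μ ν s 1 ≤ cubicMax (μ + 1) (μ + 1 + ν) :=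
    realMajorant_one μ ν s ▸ cubic_le_cubicMax hp hq hs
  rcases le_or_gt (2 * (1 - t)) (t * μ) with h | h
  · exact le_max_of_le_right ((realMajorant_le_realMajorant_one ht0 ht1 hr h).trans (hone t ht0))
  -- At `u` the vertex is `r = 1`.
  set u := 2 / (2 + μ) with hu
  have hu0 : 0 ≤ u := by positivity
  have htu : t ≤ u := by
    rw [hu, le_div_iff₀ (by linarith)]
    linarith
  have hvertex : 1 + u ^ 2 * ((μ ^ 2 / 4 - 1) + u * (μ ^ 2 / 4 - ν)) = realMajorant μ ν u 1 := by
    rw [realMajorant_one, hu]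
    field_simp
    ring
  calc realMajorant μ ν t r ≤ 1 + t ^ 2 * ((μ ^ 2 / 4 - 1) + t * (μ ^ 2 / 4 - ν)) :=
        realMajorant_le_vertex ht0
    _ ≤ max 1 (realMajorant μ ν u 1) :=
        hvertex ▸ one_add_sq_mul_le_max (by linarith) ht0 htu
    _ ≤ max 1 (cubicMax (μ + 1) (μ + 1 + ν)) := max_le_max_left 1 (hone u hu0)

lemma realMajorant_le_one (hμ : μ ≤ 1 / 2) (hν : -1 ≤ ν) (ht0 : 0 ≤ t) (ht1 : t ≤ 1)
    (hr0 : 0 ≤ r) (hr1 : r ≤ 1) : realMajorant μ ν t r ≤ 1 := by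
  have hextreme : realMajorant μ ν t r ≤ realMajorant (1 / 2) (-1) t r := by
    have hs : 0 ≤ 1 - t ^ 2 := by nlinarith
    rw [realMajorant, realMajorant]
    gcongr
  refine hextreme.trans ?_
  rcases le_total (4 / 5) t with h | h
  · refine (realMajorant_le_realMajorant_one ht0 ht1 hr1 (by linarith)).trans ?_
    rw [realMajorant_one]
    nlinarith [sq_nonneg (t - 1)]
  · refine (realMajorant_le_vertex ht0).trans ?_
    nlinarith [sq_nonneg t]

lemma exists_norm_eq_majorant_abs (μ ν t : ℝ) (X : ℂ) :
    ∃ Y : ℂ, ‖Y‖ = ‖X‖ ∧ majorant |μ| ν t Y = majorant μ ν t X := by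
  rcases abs_choice μ with h | h
  · exact ⟨X, rfl, by rw [h]⟩
  · exact ⟨-X, norm_neg X, by simp [majorant, innerTerm, h]⟩

lemma norm_innerTerm_sq (μ ν t : ℝ) (X : ℂ) :
    ‖innerTerm μ ν t X‖ ^ 2 =
      (1 - t ^ 2) ^ 2 * μ ^ 2 * ‖X‖ ^ 2 + (ν * t ^ 2 + (1 - t ^ 2) * ‖X‖ ^ 2) ^ 2 +
        2 * (1 - t ^ 2) * μ * (ν * t ^ 2 - (1 - t ^ 2) * ‖X‖ ^ 2) * X.re -
        4 * ν * t ^ 2 * (1 - t ^ 2) * X.re ^ 2 := by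
  have hX := normSq_apply X
  rw [normSq_eq_norm_sq] at hX
  rw [hX, ← normSq_eq_norm_sq, normSq_apply, innerTerm]
  simp only [← ofReal_one, ← ofReal_sub, ← ofReal_mul, add_re, add_im, sub_re, sub_im, mul_re,
    mul_im, ofReal_re, ofReal_im, pow_two]
  ring

lemma majorant_le_realMajorant_of_nonpos (hμ : 0 ≤ μ) (hν : ν ≤ 0) (ht0 : 0 ≤ t) (ht1 : t ≤ 1) :
    majorant μ ν t X ≤ realMajorant μ ν t ‖X‖ := by
  have hs : 0 ≤ 1 - t ^ 2 := sub_nonneg.2 (pow_le_one₀ ht0 ht1)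
  have hnorm : ‖innerTerm μ ν t X‖ ≤ -ν * t ^ 2 + (1 - t ^ 2) * (μ * ‖X‖ + ‖X‖ ^ 2) := by
    refine (norm_add_le _ _).trans (add_le_add (le_of_eq ?_) ?_)
    · simp [abs_of_nonpos hν]
    · have hcast : ‖(1 - t ^ 2 : ℂ)‖ = 1 - t ^ 2 := by
        exact_mod_cast Complex.norm_of_nonneg hs
      rw [norm_mul, hcast]
      gcongr
      exact (norm_sub_le _ _).trans_eq (by simp [abs_of_nonneg hμ, norm_pow])
  rw [majorant, realMajorant]
  gcongr
  linarith

/-- The condition says that in `norm_innerTerm_sq`, a concave quadratic of `X.re`, the vertex lies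
to the left of `-‖X‖`. -/
lemma majorant_le_realMajorant_of_vertex (hμ : 0 < μ) (hν : 0 < ν) (ht0 : 0 ≤ t) (ht1 : t ≤ 1)
    (h : 4 * ν * t ^ 2 * ‖X‖ ≤ μ * ((1 - t ^ 2) * ‖X‖ ^ 2 - ν * t ^ 2)) :
    majorant μ ν t X ≤ realMajorant μ ν t ‖X‖ := by
  have hs : 0 ≤ 1 - t ^ 2 := sub_nonneg.2 (pow_le_one₀ ht0 ht1)
  have hw : 0 ≤ X.re + ‖X‖ := by linarith [neg_abs_le X.re, abs_re_le_norm X]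
  have hpos : 0 ≤ (1 - t ^ 2) * ‖X‖ ^ 2 - ν * t ^ 2 :=
    nonneg_of_mul_nonneg_right (le_trans (by positivity) h) hμ
  have hnorm : ‖innerTerm μ ν t X‖ ≤ (1 - t ^ 2) * (μ * ‖X‖ + ‖X‖ ^ 2) - ν * t ^ 2 := by
    refine (abs_le_of_sq_le_sq' (sub_nonneg.1 ?_)
      (by linarith [mul_nonneg hs (mul_nonneg hμ.le (norm_nonneg X))])).2
    have hdiff : ((1 - t ^ 2) * (μ * ‖X‖ + ‖X‖ ^ 2) - ν * t ^ 2) ^ 2 - ‖innerTerm μ ν t X‖ ^ 2 =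
        (1 - t ^ 2) * (X.re + ‖X‖) * (4 * ν * t ^ 2 * (X.re + ‖X‖) +
          2 * (μ * ((1 - t ^ 2) * ‖X‖ ^ 2 - ν * t ^ 2) - 4 * ν * t ^ 2 * ‖X‖)) := by
      rw [norm_innerTerm_sq]
      ring
    rw [hdiff]
    exact mul_nonneg (mul_nonneg hs hw) (add_nonneg (by positivity) (by linarith))
  rw [majorant, realMajorant]
  gcongr

end Majorant
section CritMajorant

variable {μ ν t : ℝ} {X : ℂ}

/-- For `ν > 0`, the quotient of `t * ‖innerTerm μ ν t X‖` by `ν t² + (1 - t²) ‖X‖²` at the critical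
value of `X.re`, which maximizes the quadratic of `norm_innerTerm_sq`. -/
noncomputable def critFactor (μ ν t : ℝ) : ℝ := √(t ^ 2 + (1 - t ^ 2) * (μ ^ 2 / (4 * ν)))

/-- The value of `majorant` at the critical value of `X.re`, as a function of `r = ‖X‖`. -/
noncomputable def critMajorant (μ ν t r : ℝ) : ℝ :=
  (1 - t ^ 2) * (1 - r ^ 2) + (ν * t ^ 2 + (1 - t ^ 2) * r ^ 2) * critFactor μ ν t

lemma critFactor_sq (hν : 0 ≤ ν) (ht0 : 0 ≤ t) (ht1 : t ≤ 1) :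
    critFactor μ ν t ^ 2 = t ^ 2 + (1 - t ^ 2) * (μ ^ 2 / (4 * ν)) := by
  have hs : 0 ≤ 1 - t ^ 2 := sub_nonneg.2 (pow_le_one₀ ht0 ht1)
  exact Real.sq_sqrt (by positivity)

lemma critFactor_nonneg (μ ν t : ℝ) : 0 ≤ critFactor μ ν t := Real.sqrt_nonneg _

lemma one_le_critFactor (hν : 0 < ν) (h : 4 * ν ≤ μ ^ 2) (ht0 : 0 ≤ t) (ht1 : t ≤ 1) :
    1 ≤ critFactor μ ν t := by
  have hs : 0 ≤ 1 - t ^ 2 := sub_nonneg.2 (pow_le_one₀ ht0 ht1)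
  have hc : 1 ≤ μ ^ 2 / (4 * ν) := (one_le_div (by linarith)).2 h
  exact Real.one_le_sqrt.2 (by nlinarith)

lemma critFactor_le_one (hν : 0 < ν) (h : μ ^ 2 ≤ 4 * ν) (ht0 : 0 ≤ t) (ht1 : t ≤ 1) :
    critFactor μ ν t ≤ 1 := by
  have hs : 0 ≤ 1 - t ^ 2 := sub_nonneg.2 (pow_le_one₀ ht0 ht1)
  have hc : μ ^ 2 / (4 * ν) ≤ 1 := (div_le_one (by linarith)).2 h
  exact Real.sqrt_le_one.2 (by nlinarith)

lemma sq_mul_critFactor_sub_sq (hν : 0 < ν) (ht0 : 0 ≤ t) (ht1 : t ≤ 1) (X : ℂ) :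
    ((ν * t ^ 2 + (1 - t ^ 2) * ‖X‖ ^ 2) * critFactor μ ν t) ^ 2 -
        (t * ‖innerTerm μ ν t X‖) ^ 2 =
      (1 - t ^ 2) * (4 * ν * t ^ 2 * X.re - μ * (ν * t ^ 2 - (1 - t ^ 2) * ‖X‖ ^ 2)) ^ 2 /
        (4 * ν) := by
  rw [mul_pow _ (critFactor μ ν t), critFactor_sq hν.le ht0 ht1, mul_pow t, norm_innerTerm_sq]
  field_simp
  ring

lemma majorant_le_critMajorant (hν : 0 < ν) (ht0 : 0 ≤ t) (ht1 : t ≤ 1) :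
    majorant μ ν t X ≤ critMajorant μ ν t ‖X‖ := by
  have hs : 0 ≤ 1 - t ^ 2 := sub_nonneg.2 (pow_le_one₀ ht0 ht1)
  rw [majorant, critMajorant]
  refine add_le_add_right (abs_le_of_sq_le_sq' (sub_nonneg.1 ?_)
    (mul_nonneg (by positivity) (critFactor_nonneg μ ν t))).2 _
  rw [sq_mul_critFactor_sub_sq hν ht0 ht1]
  positivity

lemma critMajorant_eq_majorant (hν : 0 < ν) (ht0 : 0 ≤ t) (ht1 : t ≤ 1)
    (hX : 4 * ν * t ^ 2 * X.re = μ * (ν * t ^ 2 - (1 - t ^ 2) * ‖X‖ ^ 2)) :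
    critMajorant μ ν t ‖X‖ = majorant μ ν t X := by
  have hs : 0 ≤ 1 - t ^ 2 := sub_nonneg.2 (pow_le_one₀ ht0 ht1)
  have hdiff := sq_mul_critFactor_sub_sq (μ := μ) hν ht0 ht1 X
  rw [hX, sub_self, zero_pow two_ne_zero, mul_zero, zero_div, sub_eq_zero] at hdiff
  rw [majorant, critMajorant, (pow_left_inj₀ (mul_nonneg (by positivity) (critFactor_nonneg μ ν t))
    (by positivity) two_ne_zero).1 hdiff]

lemma critMajorant_le_critMajorant {r ρ : ℝ} (hκ : 1 ≤ critFactor μ ν t) (ht0 : 0 ≤ t)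
    (ht1 : t ≤ 1) (hr : 0 ≤ r) (hrρ : r ≤ ρ) : critMajorant μ ν t r ≤ critMajorant μ ν t ρ := by
  have hs : 0 ≤ 1 - t ^ 2 := sub_nonneg.2 (pow_le_one₀ ht0 ht1)
  have hsq : r ^ 2 ≤ ρ ^ 2 := by gcongr
  have hdiff : critMajorant μ ν t ρ - critMajorant μ ν t r =
      (1 - t ^ 2) * ((ρ ^ 2 - r ^ 2) * (critFactor μ ν t - 1)) := by
    simp only [critMajorant]
    ring
  exact sub_nonneg.1
    (hdiff ▸ mul_nonneg hs (mul_nonneg (sub_nonneg.2 hsq) (sub_nonneg.2 hκ)))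

lemma critMajorant_one_le {M : ℝ} (hν : 0 ≤ ν) (hM : 0 ≤ M) (ht0 : 0 ≤ t) (ht1 : t ≤ 1)
    (h : (ν * t ^ 2 + (1 - t ^ 2)) ^ 2 * (t ^ 2 + (1 - t ^ 2) * (μ ^ 2 / (4 * ν))) ≤ M ^ 2) :
    critMajorant μ ν t 1 ≤ M := by
  refine (abs_le_of_sq_le_sq' (h.trans_eq' ?_) hM).2
  rw [← critFactor_sq hν ht0 ht1, critMajorant]
  ring

lemma majorant_le_max_one_of_sq_le (hν : 0 < ν) (h : μ ^ 2 ≤ 4 * ν) (ht0 : 0 ≤ t) (ht1 : t ≤ 1) :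
    majorant μ ν t X ≤ max 1 ν := by
  have hs : 0 ≤ 1 - t ^ 2 := sub_nonneg.2 (pow_le_one₀ ht0 ht1)
  calc majorant μ ν t X ≤ critMajorant μ ν t ‖X‖ := majorant_le_critMajorant hν ht0 ht1
    _ ≤ (1 - t ^ 2) * (1 - ‖X‖ ^ 2) + (ν * t ^ 2 + (1 - t ^ 2) * ‖X‖ ^ 2) := by
        rw [critMajorant]
        gcongr
        exact mul_le_of_le_one_right (by positivity) (critFactor_le_one hν h ht0 ht1)
    _ = (1 - t ^ 2) * 1 + t ^ 2 * ν := by ring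
    _ ≤ (1 - t ^ 2) * max 1 ν + t ^ 2 * max 1 ν := by
        gcongr
        · exact le_max_left 1 ν
        · exact le_max_right 1 ν
    _ = max 1 ν := by ring

lemma majorant_le_of_sq_add_eight_le (hν : 1 ≤ ν) (h : μ ^ 2 + 8 ≤ 12 * ν) (ht0 : 0 ≤ t)
    (ht1 : t ≤ 1) (hX : ‖X‖ ≤ 1) : majorant μ ν t X ≤ ν := by
  have hν0 : 0 < ν := by linarith
  rcases le_total (μ ^ 2) (4 * ν) with hc | hc
  · exact (majorant_le_max_one_of_sq_le hν0 hc ht0 ht1).trans_eq (max_eq_right hν)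
  have hs : 0 ≤ 1 - t ^ 2 := sub_nonneg.2 (pow_le_one₀ ht0 ht1)
  have hcν : ν * (μ ^ 2 / (4 * ν)) = μ ^ 2 / 4 := by field_simp
  refine (majorant_le_critMajorant hν0 ht0 ht1).trans <|
    (critMajorant_le_critMajorant (one_le_critFactor hν0 hc ht0 ht1) ht0 ht1 (norm_nonneg X)
      hX).trans (critMajorant_one_le hν0.le hν0.le ht0 ht1 ?_)
  rw [← mul_one (ν ^ 2)]
  refine sq_mul_le_sq_mul hν0 zero_le_one (by positivity) ?_
  nlinarith

lemma sq_mul_le_cubicMax_sq (hμ : 0 < μ) (hν : 0 < ν)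
    (hd : ν * (μ ^ 2 + 2 * μ + 4) ≤ 2 * μ * (μ + 1)) {T : ℝ} (hT1 : T ≤ 1)
    (hT : μ ≤ T * (4 * ν + μ + μ * ν)) :
    (ν * T + (1 - T)) ^ 2 * (T + (1 - T) * (μ ^ 2 / (4 * ν))) ≤
      cubicMax (μ + 1) (μ + 1 + ν) ^ 2 := by
  have hT0 : 0 < T := pos_of_mul_pos_left (hμ.trans_le hT) (by positivity)
  set S := μ / (4 * ν + μ + μ * ν) with hS
  have : 0 < S := by positivity
  have hST : S ≤ T := div_le_of_le_mul₀ (by positivity) hT0.le hT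
  have hqS : (μ + 1 + ν) * S ≤ μ + 1 := by
    rw [hS, mul_div_assoc', div_le_iff₀ (by positivity)]
    nlinarith [mul_pos hμ hν, mul_pos (mul_pos hμ hν) hμ]
  have hvalue : (ν * S + (1 - S)) ^ 2 * (S + (1 - S) * (μ ^ 2 / (4 * ν))) =
      (μ + 1 - (μ + 1 + ν) * S) ^ 2 * S := by
    rw [hS]
    field_simp
    ring
  -- `hd` says that the left-hand side, as a function of `T`, is not increasing at `T = S`.
  have hslope : 2 * (ν - 1) * (S + (1 - S) * (μ ^ 2 / (4 * ν))) ≤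
      (μ ^ 2 / (4 * ν) - 1) * (ν * S + (1 - S)) := by
    have hdiff : (μ ^ 2 / (4 * ν) - 1) * (ν * S + (1 - S)) -
        2 * (ν - 1) * (S + (1 - S) * (μ ^ 2 / (4 * ν))) =
        (2 * μ * (μ + 1) - ν * (μ ^ 2 + 2 * μ + 4)) * (μ + 2) / (2 * (4 * ν + μ + μ * ν)) := by
      rw [hS]
      field_simp
      ring
    exact sub_nonneg.1 (hdiff ▸ div_nonneg (mul_nonneg (sub_nonneg.2 hd) (by linarith))
      (by positivity))
  have hS1 : 0 ≤ 1 - S := by linarith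
  have : 0 ≤ 1 - T := by linarith
  refine le_trans ?_ (hvalue.trans_le (sq_sub_mul_mul_le_cubicMax_sq (by linarith)
    (by linarith) hqS))
  refine sq_mul_le_sq_mul (by positivity) (by positivity) (by positivity) ?_
  linarith [mul_le_mul_of_nonneg_right hslope (sub_nonneg.2 hST)]

lemma exists_critical_radius {r : ℝ} (h1 : t ^ 2 * (4 * ν + μ + μ * ν) ≤ μ) (hr : r ≤ 1)
    (h : μ * ((1 - t ^ 2) * r ^ 2 - ν * t ^ 2) ≤ 4 * ν * t ^ 2 * r) :
    ∃ ρ ∈ Icc r 1, 4 * ν * t ^ 2 * ρ = μ * ((1 - t ^ 2) * ρ ^ 2 - ν * t ^ 2) := by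
  obtain ⟨ρ, hρ, hroot⟩ : (0 : ℝ) ∈ (fun ρ : ℝ =>
      μ * ((1 - t ^ 2) * ρ ^ 2 - ν * t ^ 2) - 4 * ν * t ^ 2 * ρ) '' Icc r 1 :=
    intermediate_value_Icc hr (by fun_prop) ⟨by linarith, by linarith⟩
  exact ⟨ρ, hρ, (sub_eq_zero.1 hroot).symm⟩

lemma exists_majorant_le_realMajorant (hμ : 0 < μ) (hν : 0 < ν) (hc : 4 * ν ≤ μ ^ 2)
    (ht0 : 0 ≤ t) (ht1 : t ≤ 1) (hX : ‖X‖ ≤ 1) (h : t ^ 2 * (4 * ν + μ + μ * ν) ≤ μ) :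
    ∃ r ≤ 1, majorant μ ν t X ≤ realMajorant μ ν t r := by
  rcases le_total (4 * ν * t ^ 2 * ‖X‖) (μ * ((1 - t ^ 2) * ‖X‖ ^ 2 - ν * t ^ 2)) with hg | hg
  · exact ⟨‖X‖, hX, majorant_le_realMajorant_of_vertex hμ hν ht0 ht1 hg⟩
  obtain ⟨ρ, ⟨hrρ, hρ1⟩, hρ⟩ := exists_critical_radius h hX hg
  have hnorm : ‖(-ρ : ℂ)‖ = ρ := by
    rw [norm_neg, Complex.norm_of_nonneg ((norm_nonneg X).trans hrρ)]
  refine ⟨ρ, hρ1, ?_⟩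
  calc majorant μ ν t X ≤ critMajorant μ ν t ‖X‖ := majorant_le_critMajorant hν ht0 ht1
    _ ≤ critMajorant μ ν t ρ := critMajorant_le_critMajorant
        (one_le_critFactor hν hc ht0 ht1) ht0 ht1 (norm_nonneg X) hrρ
    _ = majorant μ ν t (-ρ) := by
        rw [← critMajorant_eq_majorant hν ht0 ht1, hnorm]
        rw [hnorm, neg_re, ofReal_re]
        linarith
    _ ≤ realMajorant μ ν t ρ := by
        simpa only [hnorm] using majorant_le_realMajorant_of_vertex (X := -ρ) hμ hν ht0 ht1
          (by rw [hnorm]; exact hρ.le)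

lemma majorant_le_max_cubicMax (hμ : 0 ≤ μ) (hq : 0 < μ + 1 + ν) (hc : 4 * ν ≤ μ ^ 2)
    (hd : ν * (μ ^ 2 + 2 * μ + 4) ≤ 2 * μ * (μ + 1)) (ht0 : 0 ≤ t) (ht1 : t ≤ 1)
    (hX : ‖X‖ ≤ 1) : majorant μ ν t X ≤ max 1 (cubicMax (μ + 1) (μ + 1 + ν)) := by
  have hreal (r : ℝ) (hr : r ≤ 1) := realMajorant_le_max_cubicMax hμ hq hc ht0 ht1 hr
  rcases le_or_gt ν 0 with hν | hν
  · exact (majorant_le_realMajorant_of_nonpos hμ hν ht0 ht1).trans (hreal ‖X‖ hX)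
  have hμ0 : 0 < μ := by
    refine hμ.lt_of_ne fun h => ?_
    rw [← h] at hc
    linarith
  rcases le_total (t ^ 2 * (4 * ν + μ + μ * ν)) μ with h | h
  · obtain ⟨r, hr, hle⟩ := exists_majorant_le_realMajorant hμ0 hν hc ht0 ht1 hX h
    exact hle.trans (hreal r hr)
  calc majorant μ ν t X ≤ critMajorant μ ν t ‖X‖ := majorant_le_critMajorant hν ht0 ht1
    _ ≤ critMajorant μ ν t 1 := critMajorant_le_critMajorant
        (one_le_critFactor hν hc ht0 ht1) ht0 ht1 (norm_nonneg X) hX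
    _ ≤ cubicMax (μ + 1) (μ + 1 + ν) := critMajorant_one_le hν.le (cubicMax_nonneg (by linarith))
        ht0 ht1 (sq_mul_le_cubicMax_sq hμ0 hν hd (pow_le_one₀ ht0 ht1) h)
    _ ≤ max 1 (cubicMax (μ + 1) (μ + 1 + ν)) := le_max_right _ _

end CritMajorant
section SchurClass

variable {φ χ ω : ℂ → ℂ} {a z : ℂ}

/-- The Schur functions: analytic functions in the unit disk that are bounded by `1`. -/
def schurClass : Set (ℂ → ℂ) :=
  {φ | DifferentiableOn ℂ φ unitDisk ∧ ∀ z ∈ unitDisk, ‖φ z‖ ≤ 1}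

/-- The Schwarz functions: analytic self-maps of the unit disk that fix `0`. -/
def schwarzClass : Set (ℂ → ℂ) :=
  {ω | AnalyticOnNhd ℂ ω unitDisk ∧ MapsTo ω unitDisk unitDisk ∧ ω 0 = 0}

lemma mem_unitDisk : z ∈ unitDisk ↔ ‖z‖ < 1 := mem_ball_zero_iff

lemma zero_mem_unitDisk : (0 : ℂ) ∈ unitDisk := mem_ball_self one_pos

lemma unitDisk_mem_nhds_zero : unitDisk ∈ 𝓝 (0 : ℂ) := ball_mem_nhds 0 one_pos

lemma analyticAt_of_mem_schurClass (hφ : φ ∈ schurClass) : AnalyticAt ℂ φ 0 :=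
  hφ.1.analyticAt unitDisk_mem_nhds_zero

lemma dslope_mem_schurClass (hφ : φ ∈ schurClass) (h0 : φ 0 = 0) :
    dslope φ 0 ∈ schurClass := by
  have hmaps : MapsTo φ (ball 0 1) (closedBall (φ 0) 1) := fun z hz => by
    simpa [h0] using hφ.2 z hz
  exact ⟨(differentiableOn_dslope unitDisk_mem_nhds_zero).2 hφ.1, fun z hz => by
    simpa using norm_dslope_le_div_of_mapsTo_ball hφ.1 hmaps hz⟩

lemma schwarzClass_subset_schurClass : schwarzClass ⊆ schurClass := fun _ hω =>
  ⟨hω.1.differentiableOn, fun _ hz => (mem_unitDisk.1 (hω.2.1 hz)).le⟩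

lemma id_mul_mem_schwarzClass (hφ : φ ∈ schurClass) : (fun z => z * φ z) ∈ schwarzClass := by
  refine ⟨(differentiableOn_id.mul hφ.1).analyticOnNhd isOpen_ball, fun z hz => ?_, zero_mul _⟩
  rw [mem_unitDisk] at hz ⊢
  exact (norm_mul _ _).trans_lt
    ((mul_le_of_le_one_right (norm_nonneg z) (hφ.2 z (mem_unitDisk.2 hz))).trans_lt hz)

lemma pow_mem_schwarzClass {k : ℕ} (hk : k ≠ 0) : (fun z : ℂ => z ^ k) ∈ schwarzClass := by
  refine ⟨fun z _ => analyticAt_id.pow k, fun z hz => ?_, zero_pow hk⟩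
  rw [mem_unitDisk] at hz ⊢
  exact (norm_pow z k).trans_lt (pow_lt_one₀ (norm_nonneg z) hz hk)

lemma one_sub_mul_ne_zero (ha : ‖a‖ ≤ 1) (hz : ‖z‖ < 1) : 1 - a * z ≠ 0 :=
  (isUnit_one_sub_of_norm_lt_one <| (norm_mul a z).trans_lt
    ((mul_le_of_le_one_left (norm_nonneg z) ha).trans_lt hz)).ne_zero

lemma norm_sub_le_norm_one_sub_conj_mul (ha : ‖a‖ ≤ 1) (hz : ‖z‖ ≤ 1) :
    ‖z - a‖ ≤ ‖1 - conj a * z‖ := by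
  refine (abs_le_of_sq_le_sq' (sub_nonneg.1 ?_) (norm_nonneg _)).2
  have hdiff : ‖1 - conj a * z‖ ^ 2 - ‖z - a‖ ^ 2 = (1 - ‖a‖ ^ 2) * (1 - ‖z‖ ^ 2) := by
    simp only [← normSq_eq_norm_sq, normSq_apply, sub_re, sub_im, mul_re, mul_im, conj_re,
      conj_im, one_re, one_im]
    ring
  rw [hdiff]
  exact mul_nonneg (sub_nonneg.2 (pow_le_one₀ (norm_nonneg a) ha))
    (sub_nonneg.2 (pow_le_one₀ (norm_nonneg z) hz))

/-- A step of the Schur algorithm. If `‖φ 0‖ < 1`, then `z * χ z` is the image of `φ z` under the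
disk automorphism that maps `φ 0` to `0`; otherwise `φ` is constant. -/
lemma exists_schurClass_mul_eq (hφ : φ ∈ schurClass) :
    ∃ χ ∈ schurClass, ∀ z ∈ unitDisk,
      φ z * (1 + conj (φ 0) * (z * χ z)) = φ 0 + z * χ z := by
  rcases (hφ.2 0 zero_mem_unitDisk).eq_or_lt with ha | ha
  · refine ⟨fun _ => 0, ⟨differentiableOn_const 0, by simp⟩, fun z hz => ?_⟩
    have hmax : IsMaxOn (norm ∘ φ) unitDisk 0 :=
      isMaxOn_iff.2 fun w hw => (hφ.2 w hw).trans_eq ha.symm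
    simpa using eqOn_of_isPreconnected_of_isMaxOn_norm (convex_ball (0 : ℂ) 1).isPreconnected
      isOpen_ball hφ.1 zero_mem_unitDisk hmax hz
  · have hconj : ‖conj (φ 0)‖ < 1 := (RCLike.norm_conj _).trans_lt ha
    have hne (z : ℂ) (hz : z ∈ unitDisk) : 1 - conj (φ 0) * φ z ≠ 0 :=
      mul_comm (φ z) _ ▸ one_sub_mul_ne_zero (hφ.2 z hz) hconj
    set ψ : ℂ → ℂ := fun z => (φ z - φ 0) / (1 - conj (φ 0) * φ z) with hψ
    have hψ0 : ψ 0 = 0 := by simp [hψ]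
    have hψmem : ψ ∈ schurClass := by
      refine ⟨(hφ.1.sub_const _).div ((differentiableOn_const 1).sub (hφ.1.const_mul _)) hne,
        fun z hz => ?_⟩
      rw [hψ, norm_div]
      exact div_le_one_of_le₀ (norm_sub_le_norm_one_sub_conj_mul ha.le (hφ.2 z hz))
        (norm_nonneg _)
    refine ⟨dslope ψ 0, dslope_mem_schurClass hψmem hψ0, fun z hz => ?_⟩
    rw [mul_dslope_zero hψ0]
    linear_combination -div_mul_cancel₀ (φ z - φ 0) (hne z hz)

lemma taylorCoeff_succ_of_schur_step (hφ : AnalyticAt ℂ φ 0) (hχ : AnalyticAt ℂ χ 0)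
    (h : ∀ᶠ z in 𝓝 0, φ z * (1 + conj (φ 0) * (z * χ z)) = φ 0 + z * χ z) (n : ℕ) :
    taylorCoeff φ (n + 1) +
        conj (φ 0) * ∑ i ∈ Finset.range (n + 1), taylorCoeff φ i * taylorCoeff χ (n - i) =
      taylorCoeff χ n := by
  have hid : AnalyticAt ℂ (fun z : ℂ => z) 0 := analyticAt_id
  have hexpand : (fun z => φ z + conj (φ 0) * (z * (φ z * χ z))) =ᶠ[𝓝 0]
      fun z => φ 0 + z * χ z := by
    filter_upwards [h] with z hz
    linear_combination hz
  have hcoeff := taylorCoeff_congr hexpand (n + 1)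
  rwa [taylorCoeff_add hφ (analyticAt_const.fun_mul (hid.fun_mul (hφ.fun_mul hχ))),
    taylorCoeff_const_mul, taylorCoeff_id_mul_succ (hφ.fun_mul hχ),
    taylorCoeff_add analyticAt_const (hid.fun_mul hχ), taylorCoeff_const_succ,
    taylorCoeff_id_mul_succ hχ, zero_add, taylorCoeff_mul hφ hχ] at hcoeff

lemma taylorCoeff_of_schur_step (hφ : AnalyticAt ℂ φ 0) (hχ : AnalyticAt ℂ χ 0)
    (h : ∀ᶠ z in 𝓝 0, φ z * (1 + conj (φ 0) * (z * χ z)) = φ 0 + z * χ z) :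
    taylorCoeff φ 1 = (1 - ‖φ 0‖ ^ 2) * χ 0 ∧
      taylorCoeff φ 2 = (1 - ‖φ 0‖ ^ 2) * (taylorCoeff χ 1 - conj (φ 0) * χ 0 ^ 2) := by
  have h1 := taylorCoeff_succ_of_schur_step hφ hχ h 0
  have h2 := taylorCoeff_succ_of_schur_step hφ hχ h 1
  simp only [Finset.sum_range_succ, Finset.range_zero, Finset.sum_empty, zero_add,
    Nat.sub_self, Nat.sub_zero, taylorCoeff_zero] at h1 h2
  rw [← conj_mul']
  exact ⟨by linear_combination h1, by linear_combination h2 - conj (φ 0) * χ 0 * h1⟩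

lemma exists_schurClass_taylorCoeff_eq (hφ : φ ∈ schurClass) :
    ∃ χ ∈ schurClass, taylorCoeff φ 1 = (1 - ‖φ 0‖ ^ 2) * χ 0 ∧
      taylorCoeff φ 2 = (1 - ‖φ 0‖ ^ 2) * (taylorCoeff χ 1 - conj (φ 0) * χ 0 ^ 2) := by
  obtain ⟨χ, hχ, hstep⟩ := exists_schurClass_mul_eq hφ
  exact ⟨χ, hχ, taylorCoeff_of_schur_step (analyticAt_of_mem_schurClass hφ)
    (analyticAt_of_mem_schurClass hχ) (eventually_of_mem unitDisk_mem_nhds_zero hstep)⟩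

lemma norm_one_sub_norm_sq (hz : ‖z‖ ≤ 1) : ‖(1 - ‖z‖ ^ 2 : ℂ)‖ = 1 - ‖z‖ ^ 2 := by
  exact_mod_cast Complex.norm_of_nonneg (sub_nonneg.2 (pow_le_one₀ (norm_nonneg z) hz))

lemma norm_taylorCoeff_one_le (hφ : φ ∈ schurClass) : ‖taylorCoeff φ 1‖ ≤ 1 - ‖φ 0‖ ^ 2 := by
  obtain ⟨χ, hχ, h1, -⟩ := exists_schurClass_taylorCoeff_eq hφ
  have h0 := hφ.2 0 zero_mem_unitDisk
  rw [h1, norm_mul, norm_one_sub_norm_sq h0]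
  exact mul_le_of_le_one_right (sub_nonneg.2 (pow_le_one₀ (norm_nonneg _) h0))
    (hχ.2 0 zero_mem_unitDisk)

lemma norm_taylorCoeff_one_le_one (hω : ω ∈ schwarzClass) : ‖taylorCoeff ω 1‖ ≤ 1 := by
  simpa [hω.2.2] using norm_taylorCoeff_one_le (schwarzClass_subset_schurClass hω)

lemma exists_taylorCoeff_eq_of_mem_schwarzClass (hω : ω ∈ schwarzClass) :
    ∃ x y : ℂ, ‖x‖ ≤ 1 ∧ ‖y‖ ≤ 1 - ‖x‖ ^ 2 ∧
      taylorCoeff ω 2 = (1 - ‖taylorCoeff ω 1‖ ^ 2) * x ∧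
      taylorCoeff ω 3 = (1 - ‖taylorCoeff ω 1‖ ^ 2) * (y - conj (taylorCoeff ω 1) * x ^ 2) := by
  have hφ := dslope_mem_schurClass (schwarzClass_subset_schurClass hω) hω.2.2
  obtain ⟨χ, hχ, h2, h3⟩ := exists_schurClass_taylorCoeff_eq hφ
  have hcoeff := taylorCoeff_dslope_zero (hω.1 0 zero_mem_unitDisk) hω.2.2
  rw [← taylorCoeff_zero (dslope ω 0), hcoeff, hcoeff] at h2 h3
  exact ⟨χ 0, taylorCoeff χ 1, hχ.2 0 zero_mem_unitDisk, norm_taylorCoeff_one_le hχ, h2, h3⟩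

lemma exists_mem_schwarzClass_taylorCoeff_eq (ha : ‖a‖ ≤ 1) :
    ∃ ω ∈ schwarzClass, taylorCoeff ω 1 = a ∧ taylorCoeff ω 2 = -(1 - ‖a‖ ^ 2) ∧
      taylorCoeff ω 3 = -(1 - ‖a‖ ^ 2) * conj a := by
  have hconj : ‖conj a‖ ≤ 1 := (RCLike.norm_conj a).trans_le ha
  have hne (z : ℂ) (hz : z ∈ unitDisk) : 1 - conj a * z ≠ 0 :=
    one_sub_mul_ne_zero hconj (mem_unitDisk.1 hz)
  set φ : ℂ → ℂ := fun z => (a - z) / (1 - conj a * z) with hφdef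
  have hφ : φ ∈ schurClass := by
    refine ⟨((differentiableOn_const a).sub differentiableOn_id).div
      ((differentiableOn_const 1).sub (differentiableOn_id.const_mul _)) hne, fun z hz => ?_⟩
    rw [hφdef, norm_div, norm_sub_rev]
    exact div_le_one_of_le₀ (norm_sub_le_norm_one_sub_conj_mul ha (mem_unitDisk.1 hz).le)
      (norm_nonneg _)
  have hφ0 : φ 0 = a := by simp [hφdef]
  have hstep : ∀ᶠ z in 𝓝 0, φ z * (1 + conj (φ 0) * (z * (fun _ => -1) z)) =
      φ 0 + z * (fun _ => -1) z := by
    filter_upwards [unitDisk_mem_nhds_zero] with z hz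
    rw [hφ0]
    linear_combination div_mul_cancel₀ (a - z) (hne z hz)
  have hφan := analyticAt_of_mem_schurClass hφ
  obtain ⟨h1, h2⟩ := taylorCoeff_of_schur_step hφan analyticAt_const hstep
  rw [taylorCoeff_const_succ (-1) 0] at h2
  refine ⟨_, id_mul_mem_schwarzClass hφ, ?_, ?_, ?_⟩
  · rw [taylorCoeff_id_mul_succ hφan, taylorCoeff_zero, hφ0]
  · rw [taylorCoeff_id_mul_succ hφan, h1, hφ0]
    ring
  · rw [taylorCoeff_id_mul_succ hφan, h2, hφ0]
    ring

end SchurClass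
section SharpBounds

variable {μ ν M t : ℝ} {ω : ℂ → ℂ}

/-- The Fekete–Szegő functional of a Schwarz function. -/
noncomputable def feketeSzego (κ : ℂ) (ω : ℂ → ℂ) : ℂ :=
  taylorCoeff ω 2 + κ * taylorCoeff ω 1 ^ 2

/-- The functional of Prokhorov and Szynal on Schwarz functions. -/
noncomputable def prokhorovSzynal (μ ν : ℝ) (ω : ℂ → ℂ) : ℂ :=
  taylorCoeff ω 3 + μ * taylorCoeff ω 1 * taylorCoeff ω 2 + ν * taylorCoeff ω 1 ^ 3

/-- A set of pairs `(μ, ν)` for which the identity maximizes `‖prokhorovSzynal μ ν ·‖` among Schwarz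
functions. Unlike `D6` it has no upper bound on `|μ|`. -/
def identityRegion : Set (ℝ × ℝ) := {p | 1 ≤ p.2 ∧ p.1 ^ 2 + 8 ≤ 12 * p.2}

lemma D6_subset_identityRegion : D6 ⊆ identityRegion := fun p ⟨h2, _, h⟩ => by
  have hsq : 2 ^ 2 ≤ p.1 ^ 2 := sq_le_sq.2 (by simpa using h2)
  exact ⟨by linarith, by linarith⟩

lemma mul_le_of_four_mul_le_sq (hμ0 : 0 ≤ μ) (hμ2 : μ ≤ 2) (h : 4 * ν ≤ μ ^ 2) :
    ν * (μ ^ 2 + 2 * μ + 4) ≤ 2 * μ * (μ + 1) := by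
  have hν : ν * (μ ^ 2 + 2 * μ + 4) ≤ μ ^ 2 / 4 * (μ ^ 2 + 2 * μ + 4) := by
    gcongr
    linarith
  have : 2 * μ * (μ + 1) - μ ^ 2 / 4 * (μ ^ 2 + 2 * μ + 4) =
      μ * (2 - μ) * (μ + 2) ^ 2 / 4 := by ring
  have hnonneg : 0 ≤ μ * (2 - μ) * (μ + 2) ^ 2 / 4 :=
    div_nonneg (mul_nonneg (mul_nonneg hμ0 (sub_nonneg.2 hμ2)) (sq_nonneg _)) zero_le_four
  linarith

lemma four_mul_le_sq_of_mul_le (hμ : 2 ≤ μ) (h : ν * (μ ^ 2 + 2 * μ + 4) ≤ 2 * μ * (μ + 1)) :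
    4 * ν ≤ μ ^ 2 := by
  have : μ ^ 2 * (μ ^ 2 + 2 * μ + 4) - 4 * (2 * μ * (μ + 1)) =
      μ * (μ - 2) * (μ + 2) ^ 2 := by ring
  have hnonneg : 0 ≤ μ * (μ - 2) * (μ + 2) ^ 2 :=
    mul_nonneg (mul_nonneg (by linarith) (sub_nonneg.2 hμ)) (sq_nonneg _)
  refine le_of_mul_le_mul_right ?_ (show 0 < μ ^ 2 + 2 * μ + 4 by positivity)
  linarith

lemma majorant_le_one (h : (μ, ν) ∈ D1 ∪ D2) (ht0 : 0 ≤ t) (ht1 : t ≤ 1) {X : ℂ}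
    (hX : ‖X‖ ≤ 1) : majorant |μ| ν t X ≤ 1 := by
  have hμ := abs_nonneg μ
  have hν1 : ν ≤ 1 := h.elim (fun h => h.2.2) (fun h => h.2.2.2)
  have hμ2 : |μ| ≤ 2 := h.elim (fun h => h.1.trans (by norm_num)) (fun h => h.2.1)
  by_cases hvertex : 0 < ν ∧ |μ| ^ 2 ≤ 4 * ν
  · exact (majorant_le_max_one_of_sq_le hvertex.1 hvertex.2 ht0 ht1).trans_eq (max_eq_left hν1)
  have hc : 4 * ν ≤ |μ| ^ 2 := by
    rcases le_or_gt ν 0 with hν | hν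
    · linarith [sq_nonneg |μ|]
    · exact le_of_not_ge fun hle => hvertex ⟨hν, hle⟩
  have hcubic (hq : 4 * (|μ| + 1) ^ 3 ≤ 27 * (|μ| + 1 + ν)) : majorant |μ| ν t X ≤ 1 := by
    have hq0 : 0 < |μ| + 1 + ν := by linarith [show 0 < 4 * (|μ| + 1) ^ 3 by positivity]
    exact (majorant_le_max_cubicMax hμ hq0 hc (mul_le_of_four_mul_le_sq hμ hμ2 hc)
      ht0 ht1 hX).trans_eq (max_eq_left (cubicMax_le_one (by positivity) hq0 hq))
  rcases h with ⟨hhalf, hν, -⟩ | ⟨-, -, hν, -⟩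
  · rcases le_total ν 0 with hν0 | hν0
    · exact (majorant_le_realMajorant_of_nonpos hμ hν0 ht0 ht1).trans
        (realMajorant_le_one hhalf hν.le ht0 ht1 (norm_nonneg X) hX)
    · refine hcubic ?_
      change |μ| ≤ 1 / 2 at hhalf
      have hsq : (|μ| + 1) ^ 2 ≤ (3 / 2) ^ 2 := by
        gcongr
        linarith
      nlinarith
  · refine hcubic ?_
    linarith [show 4 / 27 * (|μ| + 1) ^ 3 - (|μ| + 1) ≤ ν from hν]

lemma le_of_mem_D8_union_D9 (h : (μ, ν) ∈ D8 ∪ D9) : -(2 / 3) * (|μ| + 1) ≤ ν :=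
  h.elim (fun h => h.2.2.1) (fun h => h.2.1)

lemma cubicMax_conditions_of_mem_D8_union_D9 (h : (μ, ν) ∈ D8 ∪ D9) :
    4 * ν ≤ |μ| ^ 2 ∧ ν * (|μ| ^ 2 + 2 * |μ| + 4) ≤ 2 * |μ| * (|μ| + 1) ∧
      27 * (|μ| + 1 + ν) ≤ 4 * (|μ| + 1) ^ 3 := by
  rcases h with ⟨hhalf, h2, -, hν⟩ | ⟨h2, -, hν⟩ <;> dsimp only at *
  · have hc : 4 * ν ≤ |μ| ^ 2 := by
      have : |μ| ^ 2 - 4 * (4 / 27 * (|μ| + 1) ^ 3 - (|μ| + 1)) =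
          (2 - |μ|) * (16 * |μ| ^ 2 + 53 * |μ| + 46) / 27 := by ring
      have hnonneg : 0 ≤ (2 - |μ|) * (16 * |μ| ^ 2 + 53 * |μ| + 46) / 27 :=
        div_nonneg (mul_nonneg (sub_nonneg.2 h2) (by positivity)) (by norm_num)
      linarith
    exact ⟨hc, mul_le_of_four_mul_le_sq (abs_nonneg μ) h2 hc, by linarith⟩
  · rw [← sq_abs μ, le_div_iff₀ (by positivity)] at hν
    have h3ν : 3 * ν ≤ |μ| + 1 := by
      refine le_of_mul_le_mul_right ?_ (show 0 < |μ| ^ 2 + 2 * |μ| + 4 by positivity)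
      nlinarith [mul_nonneg (abs_nonneg μ) (sub_nonneg.2 h2)]
    have hsq : 3 ^ 2 ≤ (|μ| + 1) ^ 2 := by
      gcongr
      linarith
    exact ⟨four_mul_le_sq_of_mul_le h2 hν, hν, by nlinarith⟩

lemma majorant_le_cubicMax (h : (μ, ν) ∈ D8 ∪ D9) (ht0 : 0 ≤ t) (ht1 : t ≤ 1) {X : ℂ}
    (hX : ‖X‖ ≤ 1) : majorant |μ| ν t X ≤ cubicMax (|μ| + 1) (|μ| + 1 + ν) := by
  have hp : 0 < |μ| + 1 := by positivity
  have hq : 0 < |μ| + 1 + ν := by linarith [le_of_mem_D8_union_D9 h]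
  obtain ⟨hc, hd, hcubic⟩ := cubicMax_conditions_of_mem_D8_union_D9 h
  exact (majorant_le_max_cubicMax (abs_nonneg μ) hq hc hd ht0 ht1 hX).trans_eq
    (max_eq_right (one_le_cubicMax hp hq hcubic))

/-- The phase of `c₁` is factored out by `c₁ = ‖c₁‖ e`, which turns `x` into
`X = x * conj e ^ 2`. -/
lemma exists_norm_prokhorovSzynal_le_majorant (μ ν : ℝ) (hω : ω ∈ schwarzClass) :
    ∃ X : ℂ, ‖X‖ ≤ 1 ∧ ‖prokhorovSzynal μ ν ω‖ ≤ majorant μ ν ‖taylorCoeff ω 1‖ X := by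
  obtain ⟨x, y, hx, hy, h2, h3⟩ := exists_taylorCoeff_eq_of_mem_schwarzClass hω
  have hc1 := norm_taylorCoeff_one_le_one hω
  set t : ℝ := ‖taylorCoeff ω 1‖
  set e : ℂ := exp (arg (taylorCoeff ω 1) * I)
  have he : ‖e‖ = 1 := norm_exp_ofReal_mul_I _
  have hconj : e * conj e = 1 := by rw [mul_conj', he, ofReal_one, one_pow]
  have hphase : taylorCoeff ω 1 = t * e := (norm_mul_exp_arg_mul_I _).symm
  have hX : ‖x * conj e ^ 2‖ = ‖x‖ := by rw [norm_mul, norm_pow, RCLike.norm_conj, he]; simp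
  refine ⟨x * conj e ^ 2, hX.trans_le hx, ?_⟩
  have hsum : prokhorovSzynal μ ν ω =
      (1 - t ^ 2) * y + t * e ^ 3 * innerTerm μ ν t (x * conj e ^ 2) := by
    rw [prokhorovSzynal, innerTerm, h2, h3, hphase, map_mul, conj_ofReal]
    linear_combination (t * (1 - t ^ 2) * x ^ 2 * conj e * (1 + e * conj e + e ^ 2 * conj e ^ 2)
      - t * (1 - t ^ 2) * μ * x * e * (1 + e * conj e)) * hconj
  calc ‖prokhorovSzynal μ ν ω‖
      ≤ (1 - t ^ 2) * ‖y‖ + t * ‖innerTerm μ ν t (x * conj e ^ 2)‖ := by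
        rw [hsum]
        refine (norm_add_le _ _).trans_eq ?_
        rw [norm_mul, norm_one_sub_norm_sq hc1, norm_mul, norm_mul, norm_pow, he, one_pow, mul_one,
          Complex.norm_of_nonneg (norm_nonneg _)]
    _ ≤ majorant μ ν t (x * conj e ^ 2) := by
        rw [majorant, hX]
        gcongr
        exact sub_nonneg.2 (pow_le_one₀ (norm_nonneg _) hc1)

lemma norm_prokhorovSzynal_le (hω : ω ∈ schwarzClass)
    (h : ∀ t : ℝ, 0 ≤ t → t ≤ 1 → ∀ X : ℂ, ‖X‖ ≤ 1 → majorant |μ| ν t X ≤ M) :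
    ‖prokhorovSzynal μ ν ω‖ ≤ M := by
  obtain ⟨X, hX, hle⟩ := exists_norm_prokhorovSzynal_le_majorant μ ν hω
  obtain ⟨Y, hY, hYX⟩ := exists_norm_eq_majorant_abs μ ν ‖taylorCoeff ω 1‖ X
  exact hle.trans (hYX ▸ h _ (norm_nonneg _) (norm_taylorCoeff_one_le_one hω) Y (hY.trans_le hX))

theorem isGreatest_norm_prokhorovSzynal_of_mem_D1_union_D2 (h : (μ, ν) ∈ D1 ∪ D2) :
    IsGreatest ((‖prokhorovSzynal μ ν ·‖) '' schwarzClass) 1 := by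
  refine ⟨⟨_, pow_mem_schwarzClass three_ne_zero, ?_⟩, forall_mem_image.2 fun ω hω =>
    norm_prokhorovSzynal_le hω fun t ht0 ht1 X hX => majorant_le_one h ht0 ht1 hX⟩
  simp [prokhorovSzynal, taylorCoeff_pow]

theorem isGreatest_norm_prokhorovSzynal_of_mem_identityRegion (h : (μ, ν) ∈ identityRegion) :
    IsGreatest ((‖prokhorovSzynal μ ν ·‖) '' schwarzClass) ν := by
  refine ⟨⟨_, pow_mem_schwarzClass one_ne_zero, ?_⟩, forall_mem_image.2 fun ω hω =>
    norm_prokhorovSzynal_le hω fun t ht0 ht1 X hX =>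
      majorant_le_of_sq_add_eight_le h.1 ((sq_abs μ).symm ▸ h.2) ht0 ht1 hX⟩
  simp [prokhorovSzynal, taylorCoeff_id, abs_of_nonneg (zero_le_one.trans h.1)]

/-- For `μ < 0` the extremal function has a purely imaginary parameter, which turns `μ` into
`-μ`. -/
lemma exists_norm_prokhorovSzynal_eq (μ ν : ℝ) (ht0 : 0 ≤ t) (ht1 : t ≤ 1) :
    ∃ ω ∈ schwarzClass,
      ‖prokhorovSzynal μ ν ω‖ = |(|μ| + 1) * t - (|μ| + 1 + ν) * t ^ 3| := by
  have ht : ‖(t : ℂ)‖ = t := Complex.norm_of_nonneg ht0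
  rcases abs_cases μ with ⟨hμ, -⟩ | ⟨hμ, -⟩
  · obtain ⟨ω, hω, h1, h2, h3⟩ := exists_mem_schwarzClass_taylorCoeff_eq (ht.trans_le ht1)
    refine ⟨ω, hω, ?_⟩
    have hval : prokhorovSzynal μ ν ω = -((μ + 1) * t - (μ + 1 + ν) * t ^ 3 : ℝ) := by
      rw [prokhorovSzynal, h1, h2, h3, ht, conj_ofReal]
      push_cast
      ring
    rw [hval, norm_neg, norm_real, Real.norm_eq_abs, hμ]
  · have htI : ‖(t * I : ℂ)‖ = t := by rw [norm_mul, norm_I, mul_one, ht]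
    obtain ⟨ω, hω, h1, h2, h3⟩ := exists_mem_schwarzClass_taylorCoeff_eq (htI.trans_le ht1)
    refine ⟨ω, hω, ?_⟩
    have hval : prokhorovSzynal μ ν ω = ((-μ + 1) * t - (-μ + 1 + ν) * t ^ 3 : ℝ) * I := by
      rw [prokhorovSzynal, h1, h2, h3, htI, map_mul, conj_ofReal, conj_I, mul_pow, I_pow_three]
      push_cast
      ring
    rw [hval, norm_mul, norm_I, mul_one, norm_real, Real.norm_eq_abs, hμ]

theorem isGreatest_norm_prokhorovSzynal_of_mem_D8_union_D9 (h : (μ, ν) ∈ D8 ∪ D9) :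
    IsGreatest ((‖prokhorovSzynal μ ν ·‖) '' schwarzClass)
      (cubicMax (|μ| + 1) (|μ| + 1 + ν)) := by
  have hp : 0 ≤ |μ| + 1 := by positivity
  refine ⟨?_, forall_mem_image.2 fun ω hω => norm_prokhorovSzynal_le hω
    fun t ht0 ht1 X hX => majorant_le_cubicMax h ht0 ht1 hX⟩
  obtain ⟨t, ht0, ht1, ht⟩ := exists_cubic_eq_cubicMax (q := |μ| + 1 + ν) hp
    (by linarith [le_of_mem_D8_union_D9 h])
  obtain ⟨ω, hω, hval⟩ := exists_norm_prokhorovSzynal_eq μ ν ht0 ht1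
  exact ⟨ω, hω, hval.trans (by rw [ht, abs_of_nonneg (cubicMax_nonneg hp)])⟩

theorem isGreatest_norm_taylorCoeff_one :
    IsGreatest ((‖taylorCoeff · 1‖) '' schwarzClass) 1 :=
  ⟨⟨_, pow_mem_schwarzClass one_ne_zero, by simp [taylorCoeff_id]⟩,
    forall_mem_image.2 fun _ => norm_taylorCoeff_one_le_one⟩

theorem isGreatest_norm_feketeSzego (κ : ℂ) :
    IsGreatest ((‖feketeSzego κ ·‖) '' schwarzClass) (max 1 ‖κ‖) := by
  constructor
  · rcases max_choice 1 ‖κ‖ with h | h <;> rw [h]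
    · exact ⟨_, pow_mem_schwarzClass two_ne_zero, by simp [feketeSzego, taylorCoeff_pow]⟩
    · exact ⟨_, pow_mem_schwarzClass one_ne_zero, by simp [feketeSzego, taylorCoeff_id]⟩
  · refine forall_mem_image.2 fun ω hω => ?_
    obtain ⟨x, -, hx, -, h2, -⟩ := exists_taylorCoeff_eq_of_mem_schwarzClass hω
    have hc1 := norm_taylorCoeff_one_le_one hω
    have hs : 0 ≤ 1 - ‖taylorCoeff ω 1‖ ^ 2 := sub_nonneg.2 (pow_le_one₀ (norm_nonneg _) hc1)
    calc ‖feketeSzego κ ω‖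
        ≤ (1 - ‖taylorCoeff ω 1‖ ^ 2) * ‖x‖ + ‖κ‖ * ‖taylorCoeff ω 1‖ ^ 2 := by
          refine (norm_add_le _ _).trans_eq ?_
          rw [h2, norm_mul, norm_one_sub_norm_sq hc1, norm_mul, norm_pow]
      _ ≤ (1 - ‖taylorCoeff ω 1‖ ^ 2) * max 1 ‖κ‖ + max 1 ‖κ‖ * ‖taylorCoeff ω 1‖ ^ 2 := by
          gcongr
          · exact hx.trans (le_max_left 1 _)
          · exact le_max_right 1 _
      _ = max 1 ‖κ‖ := by ring

end SharpBounds

section Janowski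

variable {A B : ℝ} {f ω H : ℂ → ℂ}

/-- The function `f` belongs to `classC A B` through the function `ω`: the condition that defines
`classC A B`, with the Schwarz function named instead of quantified. -/
def IsJanowskiConvexVia (A B : ℝ) (ω f : ℂ → ℂ) : Prop :=
  f ∈ classA ∧ (∀ z ∈ unitDisk, deriv f z ≠ 0) ∧
    ∀ z ∈ unitDisk, 1 + z * deriv (deriv f) z / deriv f z =
      (1 + (A : ℂ) * ω z) / (1 + (B : ℂ) * ω z)

lemma mem_classC_iff : f ∈ classC A B ↔ ∃ ω ∈ schwarzClass, IsJanowskiConvexVia A B ω f :=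
  ⟨fun ⟨hf, hne, ω, hω, hmaps, h0, h⟩ => ⟨ω, ⟨hω, hmaps, h0⟩, hf, hne, h⟩,
    fun ⟨ω, ⟨hω, hmaps, h0⟩, hf, hne, h⟩ => ⟨hf, hne, ω, hω, hmaps, h0, h⟩⟩

lemma exists_mem_classA_deriv_deriv_eq (hH : DifferentiableOn ℂ H unitDisk) :
    ∃ f ∈ classA, (∀ z ∈ unitDisk, deriv f z ≠ 0) ∧
      ∀ z ∈ unitDisk, deriv (deriv f) z = H z * deriv f z := by
  obtain ⟨F, hF0, hF⟩ := hH.isExactOn_ball.with_val_at 0 0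
  have hexp : DifferentiableOn ℂ (fun z => exp (F z)) unitDisk := fun z hz =>
    (hF z hz).cexp.differentiableAt.differentiableWithinAt
  obtain ⟨f, hf0, hf⟩ := hexp.isExactOn_ball.with_val_at 0 0
  have hderiv (z) (hz : z ∈ unitDisk) : deriv f z = exp (F z) := (hf z hz).deriv
  refine ⟨f, ⟨?_, hf0, ?_⟩, fun z hz => ?_, fun z hz => ?_⟩
  · exact DifferentiableOn.analyticOnNhd
      (fun z hz => (hf z hz).differentiableAt.differentiableWithinAt) isOpen_ball
  · rw [hderiv 0 zero_mem_unitDisk, hF0, exp_zero]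
  · exact hderiv z hz ▸ exp_ne_zero _
  · have hnhds : deriv f =ᶠ[𝓝 z] fun w => exp (F w) :=
      eventually_of_mem (isOpen_ball.mem_nhds hz) hderiv
    rw [hnhds.deriv_eq, (hF z hz).cexp.deriv, hderiv z hz, mul_comm]

lemma one_add_mul_apply_ne_zero (hB : |B| ≤ 1) (hω : ω ∈ schwarzClass) {z : ℂ}
    (hz : z ∈ unitDisk) : 1 + (B : ℂ) * ω z ≠ 0 := by
  have h := one_sub_mul_ne_zero (a := -(B : ℂ)) (by simpa using hB) (mem_unitDisk.1 (hω.2.1 hz))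
  rwa [neg_mul, sub_neg_eq_add] at h

lemma exists_isJanowskiConvexVia (A : ℝ) (hB : |B| ≤ 1) (hω : ω ∈ schwarzClass) :
    ∃ f, IsJanowskiConvexVia A B ω f := by
  have hωd : DifferentiableOn ℂ ω unitDisk := hω.1.differentiableOn
  have hne (z) (hz : z ∈ unitDisk) : 1 + (B : ℂ) * ω z ≠ 0 := one_add_mul_apply_ne_zero hB hω hz
  have hH : DifferentiableOn ℂ
      (fun z => ((A : ℂ) - B) * dslope ω 0 z / (1 + (B : ℂ) * ω z)) unitDisk :=
    (((differentiableOn_dslope unitDisk_mem_nhds_zero).2 hωd).const_mul _).div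
      ((hωd.const_mul _).const_add _) hne
  obtain ⟨f, hf, hf', hf''⟩ := exists_mem_classA_deriv_deriv_eq hH
  refine ⟨f, hf, hf', fun z hz => ?_⟩
  have hnez := hne z hz
  rw [hf'' z hz, ← mul_assoc, mul_div_cancel_right₀ _ (hf' z hz), mul_div_assoc', mul_left_comm,
    mul_dslope_zero hω.2.2]
  field_simp
  ring

namespace IsJanowskiConvexVia

lemma taylorCoeff_recurrence (h : IsJanowskiConvexVia A B ω f) (hω : ω ∈ schwarzClass) (n : ℕ) :
    n * taylorCoeff (deriv f) n + B * ∑ i ∈ Finset.range (n + 1),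
        taylorCoeff ω i * ((n - i : ℕ) * taylorCoeff (deriv f) (n - i)) =
      (A - B) * ∑ i ∈ Finset.range (n + 1), taylorCoeff ω i * taylorCoeff (deriv f) (n - i) := by
  obtain ⟨⟨hfa, -, -⟩, hne, hsub⟩ := h
  have hωa : AnalyticAt ℂ ω 0 := hω.1 0 zero_mem_unitDisk
  have hf' : AnalyticAt ℂ (deriv f) 0 := (hfa 0 zero_mem_unitDisk).deriv
  have hzf'' : AnalyticAt ℂ (fun z => z * deriv (deriv f) z) 0 := analyticAt_id.fun_mul hf'.deriv
  have hden : ∀ᶠ z in 𝓝 0, 1 + (B : ℂ) * ω z ≠ 0 :=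
    (continuousAt_const.add (continuousAt_const.mul hωa.continuousAt)).eventually_ne
      (by simp [hω.2.2])
  have heq : (fun z => z * deriv (deriv f) z + B * (ω z * (z * deriv (deriv f) z))) =ᶠ[𝓝 0]
      fun z => ((A : ℂ) - B) * (ω z * deriv f z) := by
    filter_upwards [unitDisk_mem_nhds_zero, hden] with z hz hdenz
    have hsubz := hsub z hz
    rw [eq_div_iff hdenz] at hsubz
    linear_combination deriv f z * hsubz -
      (1 + B * ω z) * div_mul_cancel₀ (z * deriv (deriv f) z) (hne z hz)
  simpa only [taylorCoeff_add hzf'' (analyticAt_const.fun_mul (hωa.fun_mul hzf'')),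
    taylorCoeff_const_mul, taylorCoeff_mul hωa hzf'', taylorCoeff_mul hωa hf',
    taylorCoeff_id_mul_deriv hf'] using taylorCoeff_congr heq n

lemma taylorCoeff_deriv_eq (h : IsJanowskiConvexVia A B ω f) (hω : ω ∈ schwarzClass) :
    taylorCoeff (deriv f) 1 = (A - B) * taylorCoeff ω 1 ∧
    taylorCoeff (deriv f) 2 =
      (A - B) / 2 * (taylorCoeff ω 2 + (A - 2 * B) * taylorCoeff ω 1 ^ 2) ∧
    taylorCoeff (deriv f) 3 =
      (A - B) / 3 * (taylorCoeff ω 3 + (3 * A - 7 * B) / 2 * taylorCoeff ω 1 * taylorCoeff ω 2 +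
        (A - 2 * B) * (A - 3 * B) / 2 * taylorCoeff ω 1 ^ 3) := by
  have hrec := h.taylorCoeff_recurrence hω
  have h1 := hrec 1
  have h2 := hrec 2
  have h3 := hrec 3
  norm_num [Finset.sum_range_succ, hω.2.2, h.1.2.2] at h1 h2 h3
  rw [h1] at h2 h3
  have h2' : taylorCoeff (deriv f) 2 =
      (A - B) / 2 * (taylorCoeff ω 2 + (A - 2 * B) * taylorCoeff ω 1 ^ 2) := by
    linear_combination h2 / 2
  rw [h2'] at h3
  exact ⟨h1, h2', by linear_combination h3 / 3⟩

lemma logCoeff_eq (h : IsJanowskiConvexVia A B ω f) (hω : ω ∈ schwarzClass) :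
    logCoeff f 1 = ((A - B) / 4 : ℝ) * taylorCoeff ω 1 ∧
    logCoeff f 2 = ((A - B) / 12 : ℝ) * feketeSzego ((A - 5 * B) / 4 : ℝ) ω ∧
    logCoeff f 3 = ((A - B) / 24 : ℝ) *
      prokhorovSzynal ((A - 5 * B) / 2) ((3 * B ^ 2 - A * B) / 2) ω := by
  have hγ := logCoeff_eq_taylorCoeff (h.1.1 0 zero_mem_unitDisk) h.1.2.1 h.1.2.2
  have hg := h.taylorCoeff_deriv_eq hω
  simp only [taylorCoeff_deriv, Nat.cast_one, Nat.cast_ofNat] at hg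
  obtain ⟨hg1, hg2, hg3⟩ := hg
  have h2 : taylorCoeff f 2 = (A - B) / 2 * taylorCoeff ω 1 := by
    linear_combination hg1 / 2
  have h3 : taylorCoeff f 3 =
      (A - B) / 6 * (taylorCoeff ω 2 + (A - 2 * B) * taylorCoeff ω 1 ^ 2) := by
    linear_combination hg2 / 3
  have h4 : taylorCoeff f 4 = (A - B) / 12 * (taylorCoeff ω 3 +
      (3 * A - 7 * B) / 2 * taylorCoeff ω 1 * taylorCoeff ω 2 +
        (A - 2 * B) * (A - 3 * B) / 2 * taylorCoeff ω 1 ^ 3) := by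
    linear_combination hg3 / 4
  rw [hγ.1, hγ.2.1, hγ.2.2, h2, h3, h4, feketeSzego, prokhorovSzynal]
  push_cast
  exact ⟨by ring, by ring, by ring⟩

end IsJanowskiConvexVia

end Janowski

section LogCoeffValues

variable {A B : ℝ}

lemma isGreatest_logCoeffValues (hB : |B| ≤ 1) {n : ℕ} {c M : ℝ} {Φ : (ℂ → ℂ) → ℂ}
    (hlog : ∀ ω ∈ schwarzClass, ∀ f, IsJanowskiConvexVia A B ω f → logCoeff f n = (c : ℂ) * Φ ω)
    (hM : IsGreatest ((‖Φ ·‖) '' schwarzClass) M) :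
    IsGreatest (logCoeffValues A B n) (|c| * M) := by
  have hnorm {ω f} (hω : ω ∈ schwarzClass) (hf : IsJanowskiConvexVia A B ω f) :
      ‖logCoeff f n‖ = |c| * ‖Φ ω‖ := by
    rw [hlog ω hω f hf, norm_mul, norm_real, Real.norm_eq_abs]
  obtain ⟨⟨ω, hω, rfl⟩, hle⟩ := hM
  refine ⟨?_, ?_⟩
  · obtain ⟨f, hf⟩ := exists_isJanowskiConvexVia A hB hω
    exact ⟨f, mem_classC_iff.2 ⟨ω, hω, hf⟩, (hnorm hω hf).symm⟩
  · rintro _ ⟨f, hf, rfl⟩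
    obtain ⟨χ, hχ, hfχ⟩ := mem_classC_iff.1 hf
    rw [hnorm hχ hfχ]
    exact mul_le_mul_of_nonneg_left (hle (mem_image_of_mem _ hχ)) (abs_nonneg c)

theorem isGreatest_logCoeffValues_one (hB : |B| ≤ 1) :
    IsGreatest (logCoeffValues A B 1) (|A - B| / 4) := by
  convert isGreatest_logCoeffValues hB (fun ω hω f hf => (hf.logCoeff_eq hω).1)
    isGreatest_norm_taylorCoeff_one using 1
  rw [abs_div, mul_one, abs_of_pos (four_pos (α := ℝ))]

theorem isGreatest_logCoeffValues_two (hB : |B| ≤ 1) :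
    IsGreatest (logCoeffValues A B 2) (|A - B| / 12 * max 1 (|A - 5 * B| / 4)) := by
  convert isGreatest_logCoeffValues hB (fun ω hω f hf => (hf.logCoeff_eq hω).2.1)
    (isGreatest_norm_feketeSzego _) using 1
  rw [norm_real, Real.norm_eq_abs, abs_div, abs_div, abs_of_pos (four_pos (α := ℝ)),
    abs_of_pos (show (0 : ℝ) < 12 by norm_num)]

theorem isGreatest_logCoeffValues_three (hB : |B| ≤ 1) {M : ℝ}
    (hM : IsGreatest ((‖prokhorovSzynal (paramPoint A B).1 (paramPoint A B).2 ·‖) '' schwarzClass)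
      M) :
    IsGreatest (logCoeffValues A B 3) (|A - B| / 24 * M) := by
  convert isGreatest_logCoeffValues hB (fun ω hω f hf => (hf.logCoeff_eq hω).2.2) hM using 1
  rw [abs_div, abs_of_pos (show (0 : ℝ) < 24 by norm_num)]

theorem isGreatest_logCoeffValues_three_of_mem_identityRegion (hB : |B| ≤ 1)
    (h : paramPoint A B ∈ identityRegion) :
    IsGreatest (logCoeffValues A B 3) (|A - B| / 48 * |B * (A - 3 * B)|) := by
  convert isGreatest_logCoeffValues_three hB
    (isGreatest_norm_prokhorovSzynal_of_mem_identityRegion h) using 1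
  have hν : B * (A - 3 * B) = -(2 * (paramPoint A B).2) := by
    rw [paramPoint]
    ring
  rw [hν, abs_neg, abs_of_nonneg (show 0 ≤ 2 * (paramPoint A B).2 by linarith [h.1])]
  ring

lemma cubicMax_half_half {P S : ℝ} (hP : 0 ≤ P) :
    cubicMax (P / 2) (S / 2) = P ^ (3 / 2 : ℝ) / (3 * √3 * √S) := by
  rw [cubicMax, mul_div_assoc' 3 S 2, div_div_div_cancel_right₀ two_ne_zero, Real.sqrt_div hP,
    Real.sqrt_mul zero_le_three, show (3 / 2 : ℝ) = 1 + 1 / 2 by norm_num,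
    Real.rpow_add' hP (by norm_num), Real.rpow_one, ← Real.sqrt_eq_rpow]
  ring

theorem isGreatest_logCoeffValues_three_of_mem_D8_union_D9 (hB : |B| ≤ 1)
    (h : paramPoint A B ∈ D8 ∪ D9) :
    IsGreatest (logCoeffValues A B 3)
      (|A - B| / (72 * √3) *
        ((|A - 5 * B| + 2) ^ (3 / 2 : ℝ) / √(|A - 5 * B| + 2 + 3 * B ^ 2 - A * B))) := by
  convert isGreatest_logCoeffValues_three hB
    (isGreatest_norm_prokhorovSzynal_of_mem_D8_union_D9 h) using 1
  have hp : |(paramPoint A B).1| + 1 = (|A - 5 * B| + 2) / 2 := by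
    rw [paramPoint, abs_div, abs_two]
    ring
  have hq : |(paramPoint A B).1| + 1 + (paramPoint A B).2 =
      (|A - 5 * B| + 2 + 3 * B ^ 2 - A * B) / 2 := by
    rw [hp, paramPoint]
    ring
  rw [hq, hp, cubicMax_half_half (by positivity)]
  ring

lemma exists_mem_classC_lt_norm_logCoeff_two (hB0 : B ≠ 0) (hB : |B| < 4 / 5) :
    ∃ f ∈ classC 0 B, 5 * |B| ^ 2 / 48 < ‖logCoeff f 2‖ := by
  obtain ⟨f, hf, hval⟩ := (isGreatest_logCoeffValues_two (A := 0) (B := B) (by linarith)).1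
  refine ⟨f, hf, hval ▸ ?_⟩
  have : 0 < |B| := abs_pos.2 hB0
  calc 5 * |B| ^ 2 / 48 = |B| / 12 * (5 / 4 * |B|) := by ring
    _ < |B| / 12 * 1 := by gcongr; linarith
    _ ≤ |0 - B| / 12 * max 1 (|0 - 5 * B| / 4) := by
      rw [zero_sub, abs_neg]
      gcongr
      exact le_max_left _ _

lemma exists_mem_classC_lt_norm_logCoeff_three (hB0 : B ≠ 0) (hB : 3 * B ^ 2 < 2) :
    ∃ f ∈ classC 0 B, |B| ^ 3 / 16 < ‖logCoeff f 3‖ := by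
  have : 0 < |B| := abs_pos.2 hB0
  have hcube := pow_mem_schwarzClass three_ne_zero
  obtain ⟨f, hf⟩ := exists_isJanowskiConvexVia 0
    (abs_le_one_iff_mul_self_le_one.2 (by linarith : B * B ≤ 1)) hcube
  refine ⟨f, mem_classC_iff.2 ⟨_, hcube, hf⟩, ?_⟩
  have hval : ‖logCoeff f 3‖ = |B| / 24 := by
    rw [(hf.logCoeff_eq hcube).2.2]
    simp [prokhorovSzynal, taylorCoeff_pow]
  calc |B| ^ 3 / 16 = |B| / 48 * (3 * B ^ 2) := by rw [← sq_abs]; ring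
    _ < |B| / 48 * 2 := by gcongr
    _ = ‖logCoeff f 3‖ := by rw [hval]; ring

end LogCoeffValues

end JanowskiConvex

open JanowskiConvex

theorem mainTheorem2_general :
    (∀ A B : ℝ, |B| ≤ 1 →
      IsGreatest (logCoeffValues A B 1) (|A - B| / 4) ∧
      (|A - 5 * B| ≤ 4 → IsGreatest (logCoeffValues A B 2) (|A - B| / 12)) ∧
      (4 < |A - 5 * B| → IsGreatest (logCoeffValues A B 2) (|A - B| / 48 * |A - 5 * B|)) ∧
      (paramPoint A B ∈ D1 ∪ D2 → IsGreatest (logCoeffValues A B 3) (|A - B| / 24)) ∧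
      (paramPoint A B ∈ identityRegion →
        IsGreatest (logCoeffValues A B 3) (|A - B| / 48 * |B * (A - 3 * B)|)) ∧
      (paramPoint A B ∈ D8 ∪ D9 → IsGreatest (logCoeffValues A B 3)
        (|A - B| / (72 * √3) *
          ((|A - 5 * B| + 2) ^ (3 / 2 : ℝ) / √(|A - 5 * B| + 2 + 3 * B ^ 2 - A * B))))) ∧
    (∀ B : ℝ, B ≠ 0 → |B| < 4 / 5 → ∃ f ∈ classC 0 B, 5 * |B| ^ 2 / 48 < ‖logCoeff f 2‖) ∧
    (∀ B : ℝ, B ≠ 0 → 3 * B ^ 2 < 2 → ∃ f ∈ classC 0 B, |B| ^ 3 / 16 < ‖logCoeff f 3‖) := by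
  refine ⟨fun A B hB => ⟨isGreatest_logCoeffValues_one hB, fun h => ?_, fun h => ?_, fun h => ?_,
    isGreatest_logCoeffValues_three_of_mem_identityRegion hB,
    isGreatest_logCoeffValues_three_of_mem_D8_union_D9 hB⟩,
    fun B => exists_mem_classC_lt_norm_logCoeff_two,
    fun B => exists_mem_classC_lt_norm_logCoeff_three⟩
  · convert isGreatest_logCoeffValues_two hB using 1
    rw [max_eq_left ((div_le_one four_pos).2 h), mul_one]
  · convert isGreatest_logCoeffValues_two hB using 1
    rw [max_eq_right ((one_le_div four_pos).2 h.le)]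
    ring
  · convert isGreatest_logCoeffValues_three hB
      (isGreatest_norm_prokhorovSzynal_of_mem_D1_union_D2 h) using 1
    rw [mul_one]

/-- Sharp bounds (`IsGreatest`: an upper bound that is attained) for the first three logarithmic
coefficients in `C(A, B)`, and the failure of the bounds `|γ₂| ≤ 5|B|²/48`, `|γ₃| ≤ |B|³/16`
in `C(0, B)`, `-0.99 ≤ B < 0`. -/
theorem mainTheorem2 :
    (∀ A B : ℝ, -1 ≤ B → B < A → A ≤ 1 →
      IsGreatest (JanowskiConvex.logCoeffValues A B 1) ((A - B) / 4) ∧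
      (|A - 5 * B| ≤ 4 →
        IsGreatest (JanowskiConvex.logCoeffValues A B 2) ((A - B) / 12)) ∧
      (4 < |A - 5 * B| →
        IsGreatest (JanowskiConvex.logCoeffValues A B 2) ((A - B) / 48 * |A - 5 * B|)) ∧
      (JanowskiConvex.paramPoint A B ∈ JanowskiConvex.D1 ∪ JanowskiConvex.D2 →
        IsGreatest (JanowskiConvex.logCoeffValues A B 3) ((A - B) / 24)) ∧
      (JanowskiConvex.paramPoint A B ∈ JanowskiConvex.D6 →
        IsGreatest (JanowskiConvex.logCoeffValues A B 3)
          ((A - B) / 48 * |B * (A - 3 * B)|)) ∧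
      (JanowskiConvex.paramPoint A B ∈ JanowskiConvex.D8 ∪ JanowskiConvex.D9 →
        IsGreatest (JanowskiConvex.logCoeffValues A B 3)
          ((A - B) / (72 * Real.sqrt 3) *
            ((|A - 5 * B| + 2) ^ (3 / 2 : ℝ) /
              Real.sqrt (|A - 5 * B| + 2 + 3 * B ^ 2 - A * B))))) ∧
    (∃ B : ℝ, -(99 / 100) ≤ B ∧ B < 0 ∧ ∃ f ∈ JanowskiConvex.classC 0 B,
      5 * |B| ^ 2 / 48 < ‖JanowskiConvex.logCoeff f 2‖) ∧
    (∃ B : ℝ, -(99 / 100) ≤ B ∧ B < 0 ∧ ∃ f ∈ JanowskiConvex.classC 0 B,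
      |B| ^ 3 / 16 < ‖JanowskiConvex.logCoeff f 3‖) := by
  obtain ⟨hsharp, h₂, h₃⟩ := mainTheorem2_general
  refine ⟨fun A B hB hBA hA => ?_,
    ⟨-(1 / 2), by norm_num, by norm_num, h₂ _ (by norm_num) (by norm_num [abs_of_pos])⟩,
    ⟨-(1 / 2), by norm_num, by norm_num, h₃ _ (by norm_num) (by norm_num)⟩⟩
  obtain ⟨hγ₁, hγ₂, hγ₂', hγ₃, hγ₃', hγ₃''⟩ :=
    abs_of_pos (sub_pos.2 hBA) ▸ hsharp A B (abs_le.2 ⟨hB, hBA.le.trans hA⟩)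
  exact ⟨hγ₁, hγ₂, hγ₂', hγ₃, fun hD6 => hγ₃' (D6_subset_identityRegion hD6), hγ₃''⟩
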